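/- **Notation.** For a partition $\nu$ with parts $\nu_1\ge\dots\ge\nu_{l(\nu)}>0$ and $|\nu|=\sum_i\nu_i$, let $\kappa_\nu=|\nu|+\sum_i(\nu_i^2-2i\nu_i)$, let $h(x)=\nu_i+\nu'_j-i-j+1$ be the hook length of the cell $x=(i,j)$ of the Young diagram of $\nu$ ($\nu'$ the transpose), $m_j(\nu)$ the number of parts equal to $j$, $z_\nu=\prod_j m_j(\nu)!\,j^{m_j(\nu)}$, and let $\chi_\nu(\mu)$ be the value of the character of the irreducible representation of $S_{|\nu|}$ indexed by $\nu$ on the class of cycle type $\mu$. Let $p_1,p_2,\dots$ be formal variables, $p_\mu=\prod_i p_{\mu_i}$, and let $\log$ denote the formal logarithm of a power series in the $p_d$ with constant term $1$. Put $$V_\nu(\lambda)=\prod_{1\le a<b\le l(\nu)}\frac{\sin[(\nu_a-\nu_b+b-a)\lambda/2]}{\sin[(b-a)\lambda/2]}\cdot\frac{1}{\prod_{i=1}^{l(\nu)}\prod_{v=1}^{\nu_i}2\sin[(v-i+l(\nu))\lambda/2]},$$ $$R(\lambda;\tau;p)=\sum_{n\ge1}\frac{(-1)^{n-1}}{n}\sum_{\mu}\Big(\sum_{\mu^1\cup\dots\cup\mu^n=\mu}\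 \prod_{i=1}^n\ \sum_{|\nu^i|=|\mu^i|}\frac{\chi_{\nu^i}(\mu^i)}{z_{\mu^i}}e^{\sqrt{-1}(\tau+\frac12)\kappa_{\nu^i}\lambda/2}V_{\nu^i}(\lambda)\Big)p_\mu,$$ the inner sum running over $n$-tuples of nonempty partitions with union $\mu$, and $$R(\lambda;\tau;p)^\bullet=\sum_{\mu}\Big(\sum_{|\nu|=|\mu|}\frac{\chi_\nu(\mu)}{z_\mu}e^{\sqrt{-1}(\tau+\frac12)\kappa_\nu\lambda/2}V_\nu(\lambda)\Big)p_\mu .$$ **Proposition.** The following hold both when $\lambda$ is a formal variable (as identities of power series in the $p_d$ over the field of Laurent series $\mathbb C((\lambda))$), and when $\lambda$ is any complex number with $\sin(d\lambda/2)\ne0$ for all integers $d\ge1$. 1. For every partition $\nu$, $\displaystyle V_\nu(\lambda)=\frac{1}{2^{|\nu|}\prod_{x\in\nu}\sin[h(x)\lambda/2]}$. 2. The series $\displaystyle \sum_{n\ge0}\sum_{|\rho|=n}\sum_{|\eta|=n}\frac{e^{\frac14\kappa_\rho\sqrt{-1}\lambda}}{\prod_{e\in\rho}2\sin(h(e)\lambda/2)}\frac{\chi_\rho(\eta)}{z_\eta}p_\eta$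 has constant term $1$, and its logarithm is $\displaystyle -\sum_{d\ge1}\frac{\sqrt{-1}^{\,d+1}p_d}{2d\sin(d\lambda/2)}$. 3. $\displaystyle R(\lambda;0;p)=\log R(\lambda;0;p)^\bullet=-\sum_{d\ge1}\frac{\sqrt{-1}^{\,d+1}p_d}{2d\sin(d\lambda/2)}$. -/

import Mathlib

/-! ## Partitions and their Young diagrams -/

namespace MarinoVafa

noncomputable section

/-- The Young diagram of a partition `ν` (rows `ν₁ ≥ ν₂ ≥ ⋯`, cells indexed from `(0, 0)`). -/
def diagram {n : ℕ} (ν : n.Partition) : YoungDiagram :=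
  YoungDiagram.ofRowLens (ν.parts.sort (· ≥ ·)) (Multiset.pairwise_sort _ _).sortedGE

/-- The length `l(ν)`: the number of parts. -/
def len {n : ℕ} (ν : n.Partition) : ℕ := Multiset.card ν.parts

/-- The `i`-th largest part `ν_i`, with `i` starting at `1`. -/
def part {n : ℕ} (ν : n.Partition) (i : ℕ) : ℕ := (diagram ν).rowLen (i - 1)

/-- `κ_ν = |ν| + ∑_i (ν_i² - 2 i ν_i)`. -/
def kappa {n : ℕ} (ν : n.Partition) : ℤ :=
  n + ∑ i ∈ Finset.Icc 1 (len ν), ((part ν i : ℤ) ^ 2 - 2 * i * part ν i)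

/-- The hook length of the cell `x = (i, j)` (indices starting at `0`):
`ν_{i+1} + ν'_{j+1} - (i+1) - (j+1) + 1`, where `ν'` is the transpose. -/
def hook {n : ℕ} (ν : n.Partition) (x : ℕ × ℕ) : ℕ :=
  (diagram ν).rowLen x.1 + (diagram ν).colLen x.2 - x.1 - x.2 - 1

theorem card_cellsOfRowLens (w : List ℕ) :
    (YoungDiagram.cellsOfRowLens w).card = w.sum := by
  induction w with
  | nil => simp [YoungDiagram.cellsOfRowLens]
  | cons a w ih =>
    rw [YoungDiagram.cellsOfRowLens, Finset.card_union_of_disjoint]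
    · simp [ih]
    · rw [Finset.disjoint_left]
      rintro ⟨i, j⟩ h1 h2
      simp only [Finset.mem_product, Finset.mem_singleton] at h1
      simp only [Finset.mem_map] at h2
      obtain ⟨⟨x, y⟩, -, h3⟩ := h2
      have h4 : Nat.succ x = i := congrArg Prod.fst h3
      omega

theorem card_diagram {n : ℕ} (ν : n.Partition) : (diagram ν).cells.card = n := by
  have h : (diagram ν).cells = YoungDiagram.cellsOfRowLens (ν.parts.sort (· ≥ ·)) := rfl
  rw [h, card_cellsOfRowLens, ← Multiset.sum_coe, Multiset.sort_eq, ν.parts_sum]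

/-! ## Irreducible characters of the symmetric groups -/

/-- A tableau of shape `ν`: a bijective filling of the cells with `0, …, n - 1`. Its choice does
not matter. -/
def tableau {n : ℕ} (ν : n.Partition) : Fin n ≃ {x // x ∈ (diagram ν).cells} :=
  (Finset.equivFinOfCardEq (card_diagram ν)).symm

/-- The Young symmetrizer `c_ν = a_ν b_ν`: the sum over the row stabilizer of the tableau times
the signed sum over its column stabilizer. -/
def youngSymmetrizer {n : ℕ} (ν : n.Partition) : MonoidAlgebra ℂ (Equiv.Perm (Fin n)) :=
  (∑ σ : Equiv.Perm (Fin n) with ∀ k, (tableau ν (σ k)).1.1 = (tableau ν k).1.1,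
      MonoidAlgebra.of ℂ _ σ) *
    ∑ σ : Equiv.Perm (Fin n) with ∀ k, (tableau ν (σ k)).1.2 = (tableau ν k).1.2,
      ((Equiv.Perm.sign σ : ℤ) : ℂ) • MonoidAlgebra.of ℂ _ σ

/-- The Specht module `ℂ[S_n] c_ν` (a left ideal of the group algebra): the irreducible
representation of `S_n` indexed by `ν`. -/
def specht {n : ℕ} (ν : n.Partition) : Ideal (MonoidAlgebra ℂ (Equiv.Perm (Fin n))) :=
  Ideal.span {youngSymmetrizer ν}

/-- `S_n` acting on the Specht module by left multiplication. -/
def spechtRep {n : ℕ} (ν : n.Partition) : Representation ℂ (Equiv.Perm (Fin n)) (specht ν) :=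
  Representation.ofModule' (specht ν)

theorem exists_perm_cycleType {n : ℕ} (η : n.Partition) :
    ∃ σ : Equiv.Perm (Fin n), σ.partition.parts = η.parts := by
  have hsum := η.parts_sum
  have hsplit := Multiset.filter_add_not (fun k => 2 ≤ k) η.parts
  obtain ⟨σ, hσ⟩ := (Equiv.Perm.exists_with_cycleType_iff (Fin n)
    (m := η.parts.filter (fun k => 2 ≤ k))).2 ⟨by
      have h := congrArg Multiset.sum hsplit
      rw [Multiset.sum_add, hsum] at h
      rw [Fintype.card_fin]
      omega, fun a ha => (Multiset.mem_filter.1 ha).2⟩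
  refine ⟨σ, ?_⟩
  have hone : η.parts.filter (fun k => ¬ 2 ≤ k) =
      Multiset.replicate (Multiset.card (η.parts.filter (fun k => ¬ 2 ≤ k))) 1 := by
    refine Multiset.eq_replicate.2 ⟨rfl, fun b hb => ?_⟩
    have h1 := Multiset.mem_filter.1 hb
    have h2 := η.parts_pos h1.1
    omega
  have hs2 : (η.parts.filter (fun k => 2 ≤ k)).sum +
      Multiset.card (η.parts.filter (fun k => ¬ 2 ≤ k)) = n := by
    have h := congrArg Multiset.sum hsplit
    rw [Multiset.sum_add, hsum, hone] at h
    simpa using h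
  have hc : Fintype.card (Fin n) - σ.support.card =
      Multiset.card (η.parts.filter (fun k => ¬ 2 ≤ k)) := by
    rw [Fintype.card_fin, ← Equiv.Perm.sum_cycleType, hσ]
    omega
  rw [Equiv.Perm.parts_partition, hσ, hc, ← hone, hsplit]

/-- `χ_ν(C(η))`: the value of the irreducible character indexed by `ν` at a permutation of
cycle type `η` (fixed points counted as parts `1`). -/
def chi {n : ℕ} (ν η : n.Partition) : ℂ :=
  (spechtRep ν).character (exists_perm_cycleType η).choose

/-! ## Formal power series in `p₁, p₂, …`

A partition `μ` is encoded by its multiplicities `m : ℕ+ →₀ ℕ`, `m d = m_d(μ)`. Thus `m` is also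
the exponent of the monomial `p_μ = ∏_d p_d ^ m_d(μ)`, and a series `∑_μ a_μ p_μ` is the
`MvPowerSeries ℕ+ K` whose coefficient at `m` is `a_μ`. The union of partitions corresponds to
the sum of multiplicity functions, the number of parts `l(μ)` to `m.degree`. -/

/-- `|μ| = ∑_d d m_d(μ)`. -/
def size (m : ℕ+ →₀ ℕ) : ℕ := m.sum fun d k => k * (d : ℕ)

/-- The partition with multiplicities `m`. -/
def toPartition (m : ℕ+ →₀ ℕ) : (size m).Partition where
  parts := m.sum fun d k => Multiset.replicate k (d : ℕ)
  parts_pos := by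
    intro i hi
    simp only [Finsupp.sum, Multiset.mem_sum] at hi
    obtain ⟨d, _, hd⟩ := hi
    rw [Multiset.eq_of_mem_replicate hd]
    exact d.pos
  parts_sum := by
    simp [Finsupp.sum, size, Multiset.sum_sum]

/-- `z_μ = ∏_d m_d(μ)! d ^ m_d(μ)`. -/
def zee (m : ℕ+ →₀ ℕ) : ℕ := m.prod fun d k => k.factorial * (d : ℕ) ^ k

section Series

variable {K : Type*} [Field K] [Algebra ℂ K] [Algebra ℚ K]

/-- The logarithm `∑_{k ≥ 1} (-1)^(k-1) (F - 1)^k / k` of a power series `F` with constant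
term `1`. -/
def logSeries (F : MvPowerSeries ℕ+ K) : MvPowerSeries ℕ+ K :=
  PowerSeries.subst (F - 1) (PowerSeries.log K)

/-! In the following definitions `ex a` and `sn a` stand for `exp (a λ)` and `sin (a λ)`
(`a` a complex constant); they are instantiated further down. -/

/-- `V_ν(λ) = ∏_{1 ≤ a < b ≤ l(ν)} sin[(ν_a - ν_b + b - a)λ/2] / sin[(b - a)λ/2]
  · 1 / ∏_{i=1}^{l(ν)} ∏_{v=1}^{ν_i} 2 sin[(v - i + l(ν))λ/2]`. -/
def V (sn : ℂ → K) {n : ℕ} (ν : n.Partition) : K :=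
  (∏ b ∈ Finset.Icc 1 (len ν), ∏ a ∈ Finset.Ico 1 b,
      sn (((part ν a : ℂ) - part ν b + b - a) / 2) / sn (((b : ℂ) - a) / 2)) *
    (1 / ∏ i ∈ Finset.Icc 1 (len ν), ∏ v ∈ Finset.Icc 1 (part ν i),
      (2 * sn (((v : ℂ) - i + len ν) / 2)))

/-- `∏_{x ∈ ν} 2 sin(h(x)λ/2)`. -/
def hookProd (sn : ℂ → K) {n : ℕ} (ν : n.Partition) : K :=
  ∏ x ∈ (diagram ν).cells, 2 * sn ((hook ν x : ℂ) / 2)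

/-- The coefficient
`∑_{|ν| = |μ|} χ_ν(C(μ)) / z_μ · e^{√-1 (τ + 1/2) κ_ν λ/2} V_ν(λ)`. -/
def coeffRBullet (ex sn : ℂ → K) (τ : ℂ) (m : ℕ+ →₀ ℕ) : K :=
  ∑ ν : (size m).Partition, algebraMap ℂ K (chi ν (toPartition m) / zee m) *
    ex (Complex.I * (τ + 1 / 2) * kappa ν / 2) * V sn ν

/-- The series `R(λ; τ; p)^• = ∑_{|μ| ≥ 0} (coeffRBullet μ) p_μ`. -/
def RBullet (ex sn : ℂ → K) (τ : ℂ) : MvPowerSeries ℕ+ K :=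
  fun m => coeffRBullet ex sn τ m

/-- The series `R(λ; τ; p) = ∑_{k ≥ 1} (-1)^(k-1)/k ∑_μ (∑_{μ¹ ∪ ⋯ ∪ μᵏ = μ} ∏_i
∑_{|νⁱ| = |μⁱ|} χ_{νⁱ}(C(μⁱ))/z_{μⁱ} · e^{√-1 (τ + 1/2) κ_{νⁱ} λ/2} V_{νⁱ}(λ)) p_μ`, the inner
sum being over `k`-tuples of nonempty partitions. There is no such tuple for `k > l(μ)`. -/
def R (ex sn : ℂ → K) (τ : ℂ) : MvPowerSeries ℕ+ K :=
  fun m => ∑ k ∈ Finset.Icc 1 m.degree, algebraMap ℂ K ((-1) ^ (k - 1) / k) *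
    ∑ f ∈ (Finset.univ : Finset (Fin k)).piAntidiag m with ∀ i, f i ≠ 0,
      ∏ i, coeffRBullet ex sn τ (f i)

/-- The series `∑_{n ≥ 0} ∑_{|ρ| = n} ∑_{|η| = |ρ|}
e^{κ_ρ √-1 λ/4} / ∏_{e ∈ ρ} 2 sin(h(e)λ/2) · χ_ρ(η) / z_η · p_η`. -/
def hookSeries (ex sn : ℂ → K) : MvPowerSeries ℕ+ K :=
  fun m => ∑ ρ : (size m).Partition, ex (1 / 4 * kappa ρ * Complex.I) / hookProd sn ρ *
    algebraMap ℂ K (chi ρ (toPartition m) / zee m)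

/-- The series `- ∑_{d ≥ 1} √-1^{d+1} p_d / (2 d sin(dλ/2))`. Only the `d` in the support of the
exponent `m` can contribute to the coefficient at `m`. -/
def closedForm (sn : ℂ → K) : MvPowerSeries ℕ+ K :=
  fun m => - ∑ d ∈ m.support, algebraMap ℂ K (Complex.I ^ ((d : ℕ) + 1)) /
    (2 * ((d : ℕ) : K) * sn (((d : ℕ) : ℂ) / 2)) *
      MvPowerSeries.coeff m (MvPowerSeries.X d : MvPowerSeries ℕ+ K)

end Series

/-! ## The two readings of `λ` -/

/-- `exp (a λ)` for a formal variable `λ`, as a Laurent series in `λ`. -/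
def formalExp (a : ℂ) : LaurentSeries ℂ :=
  ((PowerSeries.rescale a (PowerSeries.exp ℂ) : PowerSeries ℂ) : LaurentSeries ℂ)

/-- `sin (a λ)` for a formal variable `λ`, as a Laurent series in `λ`. -/
def formalSin (a : ℂ) : LaurentSeries ℂ :=
  ((PowerSeries.rescale a (PowerSeries.sin ℂ) : PowerSeries ℂ) : LaurentSeries ℂ)

/-- `exp (a λ)` for a complex number `λ`. -/
def numExp (lam a : ℂ) : ℂ := Complex.exp (a * lam)

/-- `sin (a λ)` for a complex number `λ`. -/
def numSin (lam a : ℂ) : ℂ := Complex.sin (a * lam)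

end

end MarinoVafa

/-! The product formula for `V` follows row by row: in a row of the diagram, the hook lengths and
the differences `ℓ_i - ℓ_b` of the shifted row lengths together run exactly once through `1, …, ℓ_i`
(`prod_diff_mul_prod_hookLen`), so `V` telescopes to the inverse of the hook product.

For the series, put `q = exp(-√-1 λ)`. The identity `2 ∑ h(x) = κ_ν + 4 n(ν) + 2 |ν|`
(`two_mul_sum_hook`) turns the phase divided by the hook product into `(√-1 q^{1/2})^{|ν|}` times
`q^{n(ν)} ∏ 1/(1 - q^{h(x)})`, the Schur function of `ν` at `1, q, q², …`. Expanding power sums in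
Schur functions at this point (`prod_inv_one_sub_pow`) collapses the sum over `ν` to `∏ 1/(1 -
q^{μ_i})`. Divided by `z_μ`, this is a coefficient of `exp(∑ a_d p_d)`, whose logarithm is the
asserted linear series. Framing zero makes `R^•` the same series, and `R` is its logarithm expanded
into tuples.

The power sum expansion is Frobenius' formula, which requires the character of the Specht module.
Let `ψ` be the alternating sum of permutation characters `altChar`. The Specht character `χ` has `∑
χ² = n!`, from the quasi-idempotence of the Young symmetrizer; `∑ χ ψ = n!`, because
column-injective fillings leave only the identity term; and `∑ ψ² = n!`, by Jacobi-Trudi. Hence `∑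
(χ - ψ)² = 0`, and both functions are real, so `χ = ψ`. No orthogonality between different shapes is
used. Comparing coefficients of alternants then gives Frobenius' formula
(`alternant_mul_cyclePoly`). At `x_i = q^i` the alternants become Vandermonde products, both sides
are polynomials in `q^N`, and setting that quantity to zero passes to infinitely many variables. -/

namespace MarinoVafa

noncomputable section

open Finset Equiv

variable {n : ℕ}

/-! ### Rows and columns of the tableau -/

/-- The row of the entry `k` in the tableau of shape `ν`. -/
def rowIdx (ν : n.Partition) (k : Fin n) : ℕ := (tableau ν k).1.1

/-- The column of the entry `k` in the tableau of shape `ν`. -/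
def colIdx (ν : n.Partition) (k : Fin n) : ℕ := (tableau ν k).1.2

theorem rowIdx_colIdx_mem (ν : n.Partition) (k : Fin n) :
    (rowIdx ν k, colIdx ν k) ∈ diagram ν := (tableau ν k).2

theorem rowIdx_lt_colLen (ν : n.Partition) (k : Fin n) :
    rowIdx ν k < (diagram ν).colLen (colIdx ν k) :=
  YoungDiagram.mem_iff_lt_colLen.1 (rowIdx_colIdx_mem ν k)

theorem eq_of_rowIdx_colIdx {ν : n.Partition} {k l : Fin n} (h1 : rowIdx ν k = rowIdx ν l)
    (h2 : colIdx ν k = colIdx ν l) : k = l :=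
  (tableau ν).injective (Subtype.ext (Prod.ext h1 h2))

theorem exists_rowIdx_colIdx (ν : n.Partition) {i j : ℕ} (h : (i, j) ∈ diagram ν) :
    ∃ k, rowIdx ν k = i ∧ colIdx ν k = j :=
  ⟨(tableau ν).symm ⟨(i, j), h⟩, by simp [rowIdx], by simp [colIdx]⟩

/-! ### Fillings without repetition in the columns -/

theorem card_column_rowIdx_lt (ν : n.Partition) (K j : ℕ) :
    #{k | rowIdx ν k < K ∧ colIdx ν k = j} = min K ((diagram ν).colLen j) := by
  rw [← card_range (min K ((diagram ν).colLen j))]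
  refine card_nbij (rowIdx ν) ?_ ?_ ?_
  · intro k hk
    have hk' := (mem_filter.1 hk).2
    have := rowIdx_lt_colLen ν k
    rw [hk'.2] at this
    simp [hk'.1, this]
  · intro k hk l hl h
    have hk' := (mem_filter.1 hk).2
    have hl' := (mem_filter.1 hl).2
    exact eq_of_rowIdx_colIdx h (hk'.2.trans hl'.2.symm)
  · intro i hi
    have hi' := mem_range.1 hi
    obtain ⟨k, h1, h2⟩ := exists_rowIdx_colIdx ν (i := i) (j := j)
      (YoungDiagram.mem_iff_lt_colLen.2 (lt_of_lt_of_le hi' (min_le_right _ _)))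
    exact ⟨k, by simp [h1, h2, lt_of_lt_of_le hi' (min_le_left _ _)], h1⟩

theorem card_column (ν : n.Partition) (j : ℕ) :
    #{k | colIdx ν k = j} = (diagram ν).colLen j := by
  have h := card_column_rowIdx_lt ν ((diagram ν).colLen j) j
  rw [min_self] at h
  rw [← h]
  congr 1
  ext k
  simp only [mem_filter, mem_univ, true_and, iff_and_self]
  rintro rfl
  exact rowIdx_lt_colLen ν k

/-- The filling `t` has no repeated entry in any column. -/
def ColInj (ν : n.Partition) (t : Fin n → ℕ) : Prop :=
  ∀ k l, colIdx ν k = colIdx ν l → t k = t l → k = l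

/-- Distinct entries below `K` number at most `K`, and at most the height of the column. The row
filling attains the smaller of these bounds; summed over columns this is the dominance order. -/
theorem ColInj.card_column_lt_le {ν : n.Partition} {t : Fin n → ℕ} (ht : ColInj ν t) (K j : ℕ) :
    #{k | t k < K ∧ colIdx ν k = j} ≤ #{k | rowIdx ν k < K ∧ colIdx ν k = j} := by
  rw [card_column_rowIdx_lt]
  refine le_min ?_ ?_
  · rw [← card_range K]
    refine card_le_card_of_injOn t (fun k hk => ?_) fun k hk l hl h => ?_
    · simpa using (mem_filter.1 hk).2.1
    · exact ht k l ((mem_filter.1 hk).2.2.trans (mem_filter.1 hl).2.2.symm) h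
  · rw [← card_column]
    exact card_le_card fun k hk => by simp [(mem_filter.1 hk).2.2]

theorem card_lt_eq_sum_column (ν : n.Partition) (t : Fin n → ℕ) (K : ℕ) :
    #{k | t k < K} = ∑ j ∈ univ.image (colIdx ν), #{k | t k < K ∧ colIdx ν k = j} := by
  rw [card_eq_sum_card_fiberwise (f := colIdx ν) (t := univ.image (colIdx ν))]
  · simp [filter_filter]
  · intro k _
    simp

theorem ColInj.card_lt_le {ν : n.Partition} {t : Fin n → ℕ} (ht : ColInj ν t) (K : ℕ) :
    #{k | t k < K} ≤ #{k | rowIdx ν k < K} := by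
  rw [card_lt_eq_sum_column ν t, card_lt_eq_sum_column ν (rowIdx ν)]
  exact sum_le_sum fun j _ => ht.card_column_lt_le K j

/-- Equality of the totals forces equality in every column. Taking `K` to be the height of the
column, all its entries must lie below `K`. -/
theorem ColInj.lt_colLen {ν : n.Partition} {t : Fin n → ℕ} (ht : ColInj ν t)
    (h : ∀ K, #{k | t k < K} = #{k | rowIdx ν k < K}) (k : Fin n) :
    t k < (diagram ν).colLen (colIdx ν k) := by
  set K := (diagram ν).colLen (colIdx ν k) with hK
  have h1 := h K
  rw [card_lt_eq_sum_column ν t, card_lt_eq_sum_column ν (rowIdx ν),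
    sum_eq_sum_iff_of_le fun j _ => ht.card_column_lt_le K j] at h1
  have h2 := h1 (colIdx ν k) (by simp)
  rw [card_column_rowIdx_lt, ← hK, min_self] at h2
  replace h2 := h2.trans (card_column ν (colIdx ν k)).symm
  have h4 : k ∈ ({l | colIdx ν l = colIdx ν k} : Finset (Fin n)) := by simp
  rw [← eq_of_subset_of_card_le (fun l hl => by simp [(mem_filter.1 hl).2.2]) h2.ge] at h4
  exact (mem_filter.1 h4).2.1

/-- A filling with the content of the row superstandard filling and no repetition in the columns
is a column rearrangement of it. -/
theorem ColInj.exists_perm {ν : n.Partition} {t : Fin n → ℕ} (ht : ColInj ν t)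
    (h : ∀ K, #{k | t k < K} = #{k | rowIdx ν k < K}) :
    ∃ σ : Perm (Fin n), (∀ k, colIdx ν (σ k) = colIdx ν k) ∧ ∀ k, rowIdx ν (σ k) = t k := by
  choose f hf1 hf2 using fun k => exists_rowIdx_colIdx ν
    (YoungDiagram.mem_iff_lt_colLen.2 (ht.lt_colLen h k))
  have hinj : Function.Injective f := fun k l hkl =>
    ht k l ((hf2 k).symm.trans ((congrArg _ hkl).trans (hf2 l)))
      ((hf1 k).symm.trans ((congrArg _ hkl).trans (hf1 l)))
  exact ⟨Equiv.ofBijective f (Finite.injective_iff_bijective.1 hinj), hf2, hf1⟩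

/-! ### The Young symmetrizer -/

/-- The row stabilizer of the tableau. -/
def rowStab (ν : n.Partition) : Finset (Perm (Fin n)) :=
  {σ | ∀ k, rowIdx ν (σ k) = rowIdx ν k}

/-- The column stabilizer of the tableau. -/
def colStab (ν : n.Partition) : Finset (Perm (Fin n)) :=
  {σ | ∀ k, colIdx ν (σ k) = colIdx ν k}

theorem mem_rowStab {ν : n.Partition} {σ : Perm (Fin n)} :
    σ ∈ rowStab ν ↔ ∀ k, rowIdx ν (σ k) = rowIdx ν k := by simp [rowStab]

theorem mem_colStab {ν : n.Partition} {σ : Perm (Fin n)} :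
    σ ∈ colStab ν ↔ ∀ k, colIdx ν (σ k) = colIdx ν k := by simp [colStab]

theorem mul_mem_rowStab {ν : n.Partition} {σ τ : Perm (Fin n)} (hσ : σ ∈ rowStab ν)
    (hτ : τ ∈ rowStab ν) : σ * τ ∈ rowStab ν := by
  rw [mem_rowStab] at *
  intro k
  rw [Perm.mul_apply, hσ, hτ]

theorem mul_mem_colStab {ν : n.Partition} {σ τ : Perm (Fin n)} (hσ : σ ∈ colStab ν)
    (hτ : τ ∈ colStab ν) : σ * τ ∈ colStab ν := by
  rw [mem_colStab] at *
  intro k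
  rw [Perm.mul_apply, hσ, hτ]

theorem inv_mem_rowStab {ν : n.Partition} {σ : Perm (Fin n)} (hσ : σ ∈ rowStab ν) :
    σ⁻¹ ∈ rowStab ν := by
  rw [mem_rowStab] at *
  intro k
  rw [← hσ, Perm.inv_def, apply_symm_apply]

theorem inv_mem_colStab {ν : n.Partition} {σ : Perm (Fin n)} (hσ : σ ∈ colStab ν) :
    σ⁻¹ ∈ colStab ν := by
  rw [mem_colStab] at *
  intro k
  rw [← hσ, Perm.inv_def, apply_symm_apply]

/-- The coefficients of the Young symmetrizer. -/
def symCoeff (ν : n.Partition) (g : Perm (Fin n)) : ℂ := (youngSymmetrizer ν).coeff g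

theorem sum_symCoeff_mul (ν : n.Partition) (φ : Perm (Fin n) → ℂ) :
    ∑ g, symCoeff ν g * φ g =
      ∑ r ∈ rowStab ν, ∑ k ∈ colStab ν, ((Perm.sign k : ℤ) : ℂ) * φ (r * k) := by
  have h : ∀ g, symCoeff ν g = ∑ r ∈ rowStab ν, ∑ k ∈ colStab ν,
      if r * k = g then ((Perm.sign k : ℤ) : ℂ) else 0 := by
    intro g
    rw [symCoeff, youngSymmetrizer, sum_mul_sum, MonoidAlgebra.coeff_sum, Finsupp.finsetSum_apply]
    refine sum_congr rfl fun r _ => ?_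
    rw [MonoidAlgebra.coeff_sum, Finsupp.finsetSum_apply]
    refine sum_congr rfl fun k _ => ?_
    simp [MonoidAlgebra.of_apply, MonoidAlgebra.single_mul_single, Finsupp.single_apply]
  simp_rw [h, sum_mul]
  rw [sum_comm]
  refine sum_congr rfl fun r _ => ?_
  rw [sum_comm]
  refine sum_congr rfl fun k _ => ?_
  simp [ite_mul]

theorem symCoeff_eq (ν : n.Partition) (g : Perm (Fin n)) :
    symCoeff ν g = ∑ r ∈ rowStab ν, ∑ k ∈ colStab ν,
      if r * k = g then ((Perm.sign k : ℤ) : ℂ) else 0 := by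
  have h := sum_symCoeff_mul ν (fun x => if x = g then 1 else 0)
  simpa using h

theorem star_symCoeff (ν : n.Partition) (g : Perm (Fin n)) :
    star (symCoeff ν g) = symCoeff ν g := by
  simp only [symCoeff_eq, star_sum]
  refine sum_congr rfl fun r _ => sum_congr rfl fun k _ => ?_
  split_ifs <;> simp

/-- A permutation preserving both rows and columns fixes every cell, so `1 = r k` only for `r = k =
1`. -/
theorem symCoeff_one (ν : n.Partition) : symCoeff ν 1 = 1 := by
  have hR : (1 : Perm (Fin n)) ∈ rowStab ν := by simp [mem_rowStab]
  have hC : (1 : Perm (Fin n)) ∈ colStab ν := by simp [mem_colStab]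
  rw [symCoeff_eq, sum_eq_single_of_mem 1 hR, sum_eq_single_of_mem 1 hC]
  · simp
  · intro k _ hk
    simp [hk]
  · intro r hr hr1
    refine sum_eq_zero fun k hk => if_neg fun h => hr1 ?_
    have h1 : r⁻¹ = k := by rw [inv_eq_iff_mul_eq_one, h]
    have h2 := inv_mem_rowStab hr
    rw [h1] at h2
    have h3 : k = 1 := by
      ext1 x
      exact eq_of_rowIdx_colIdx (mem_rowStab.1 h2 x) (mem_colStab.1 hk x)
    rwa [h3, inv_eq_one] at h1

theorem symCoeff_row_mul {ν : n.Partition} {r : Perm (Fin n)} (hr : r ∈ rowStab ν)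
    (g : Perm (Fin n)) : symCoeff ν (r * g) = symCoeff ν g := by
  rw [symCoeff_eq, symCoeff_eq]
  refine sum_bij' (fun s _ => r⁻¹ * s) (fun s _ => r * s)
    (fun s hs => mul_mem_rowStab (inv_mem_rowStab hr) hs) (fun s hs => mul_mem_rowStab hr hs)
    (by simp) (by simp) fun s _ => sum_congr rfl fun k _ => ?_
  simp [mul_assoc, inv_mul_eq_iff_eq_mul]

theorem symCoeff_mul_col {ν : n.Partition} {k : Perm (Fin n)} (hk : k ∈ colStab ν)
    (g : Perm (Fin n)) : symCoeff ν (g * k) = ((Perm.sign k : ℤ) : ℂ) * symCoeff ν g := by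
  rw [symCoeff_eq, symCoeff_eq, mul_sum]
  refine sum_congr rfl fun r _ => ?_
  rw [mul_sum]
  refine sum_bij' (fun s _ => s * k⁻¹) (fun s _ => s * k)
    (fun s hs => mul_mem_colStab hs (inv_mem_colStab hk)) (fun s hs => mul_mem_colStab hs hk)
    (by simp) (by simp) fun s _ => ?_
  have h : r * (s * k⁻¹) = g ↔ r * s = g * k := by
    rw [← mul_assoc, mul_inv_eq_iff_eq_mul]
  simp only [h]
  split_ifs
  · rcases Int.units_eq_one_or (Perm.sign k) with h1 | h1 <;> simp [h1]
  · simp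

/-- Fill each cell with the row to which `g` sends its entry. If no column repeats a value, this is
a column rearrangement of the row filling and `g` factors; otherwise two entries of one column are
sent to a common row, and their transposition serves. -/
theorem mem_mul_or_exists_swap (ν : n.Partition) (g : Perm (Fin n)) :
    (∃ r ∈ rowStab ν, ∃ k ∈ colStab ν, g = r * k) ∨
      ∃ p q, p ≠ q ∧ swap p q ∈ colStab ν ∧ g * swap p q * g⁻¹ ∈ rowStab ν := by
  by_cases ht : ColInj ν (fun k => rowIdx ν (g k))
  · left
    obtain ⟨σ, h1, h2⟩ := ht.exists_perm fun K => by
      refine card_equiv g fun k => by simp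
    refine ⟨g * σ⁻¹, ?_, σ, mem_colStab.2 h1, by simp⟩
    rw [mem_rowStab]
    intro k
    rw [Perm.mul_apply, ← h2, Perm.inv_def, apply_symm_apply]
  · right
    simp only [ColInj, not_forall] at ht
    obtain ⟨p, q, h1, h2, h3⟩ := ht
    refine ⟨p, q, h3, ?_, ?_⟩
    · rw [mem_colStab]
      intro k
      rw [swap_apply_def]
      split_ifs with ha hb
      · rw [ha, h1]
      · rw [hb, h1]
      · rfl
    · have h4 : g * swap p q * g⁻¹ = swap (g p) (g q) := (swap_apply_apply g p q).symm
      rw [h4, mem_rowStab]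
      intro k
      rw [swap_apply_def]
      split_ifs with ha hb
      · rw [ha, h2]
      · rw [hb, h2]
      · rfl

/-- A function on the symmetric group which is invariant under the row stabilizer on the left and
sign-equivariant under the column stabilizer on the right is a multiple of the Young symmetrizer. -/
theorem eq_mul_symCoeff {ν : n.Partition} {y : Perm (Fin n) → ℂ}
    (h1 : ∀ r ∈ rowStab ν, ∀ g, y (r * g) = y g)
    (h2 : ∀ k ∈ colStab ν, ∀ g, y (g * k) = ((Perm.sign k : ℤ) : ℂ) * y g) (g : Perm (Fin n)) :
    y g = y 1 * symCoeff ν g := by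
  rcases mem_mul_or_exists_swap ν g with ⟨r, hr, k, hk, rfl⟩ | ⟨p, q, hpq, hC, hR⟩
  · rw [h1 r hr, symCoeff_row_mul hr, ← one_mul k, h2 k hk, symCoeff_mul_col hk, symCoeff_one]
    ring
  -- With `s = swap p q`, the row element `g s g⁻¹` gives `z g = z (g s)`, while the column rule
  -- gives `z (g s) = -z g`.
  · have key : ∀ z : Perm (Fin n) → ℂ, (∀ r ∈ rowStab ν, ∀ g, z (r * g) = z g) →
        (∀ k ∈ colStab ν, ∀ g, z (g * k) = ((Perm.sign k : ℤ) : ℂ) * z g) → z g = 0 := by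
      intro z h1 h2
      have h3 := h1 _ hR g
      rw [inv_mul_cancel_right, h2 _ hC, Perm.sign_swap hpq] at h3
      simp only [Units.val_neg, Units.val_one, Int.cast_neg, Int.cast_one, neg_mul, one_mul] at h3
      exact self_eq_neg.1 h3.symm
    rw [key y h1 h2, key (symCoeff ν) (fun r hr => symCoeff_row_mul hr)
      (fun k hk => symCoeff_mul_col hk), mul_zero]

end

end MarinoVafa

namespace MarinoVafa

noncomputable section

open Finset Equiv

variable {n : ℕ}

/-! ### The Specht character -/

theorem coeff_mul_eq_sum {G : Type*} [Group G] [Fintype G] (x y : MonoidAlgebra ℂ G) (g : G) :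
    (x * y).coeff g = ∑ h, x.coeff h * y.coeff (h⁻¹ * g) := by
  rw [MonoidAlgebra.coeff_mul_apply_left, Finsupp.sum_fintype _ _ fun _ => by simp]

/-- In the basis of group elements, the diagonal entry at `x` is the coefficient of `x` in `g x v`.
-/
theorem trace_mulLeft_mulRight {G : Type*} [Group G] [Fintype G] (g : G) (v : MonoidAlgebra ℂ G) :
    LinearMap.trace ℂ (MonoidAlgebra ℂ G)
        (LinearMap.mulLeft ℂ (MonoidAlgebra.of ℂ G g) ∘ₗ LinearMap.mulRight ℂ v) =
      ∑ x, v.coeff (x⁻¹ * g⁻¹ * x) := by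
  classical
  rw [LinearMap.trace_eq_matrix_trace ℂ (MonoidAlgebra.basis G ℂ), Matrix.trace]
  refine sum_congr rfl fun x _ => ?_
  rw [Matrix.diag_apply, LinearMap.toMatrix_apply, MonoidAlgebra.basis_apply]
  change (MonoidAlgebra.of ℂ G g * (MonoidAlgebra.single x 1 * v)).coeff x = _
  simp [MonoidAlgebra.of_apply, mul_assoc]

/-- The scalar `m` with `c ^ 2 = m c` for the Young symmetrizer `c`. -/
def symScalar (ν : n.Partition) : ℂ := ∑ h, symCoeff ν h * symCoeff ν h⁻¹

/-- The left side is the coefficient at `g` of `c x c`, with `c` the Young symmetrizer. This product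
inherits the row and column equivariance of `c`, so it is a multiple of `c`. -/
theorem symCoeff_conv (ν : n.Partition) (x g : Perm (Fin n)) :
    ∑ h, symCoeff ν h * symCoeff ν (x⁻¹ * h⁻¹ * g) =
      (∑ h, symCoeff ν h * symCoeff ν (x⁻¹ * h⁻¹)) * symCoeff ν g := by
  have h := eq_mul_symCoeff (ν := ν)
    (y := fun g => ∑ h, symCoeff ν h * symCoeff ν (x⁻¹ * h⁻¹ * g)) (fun r hr g => ?_)
    (fun k hk g => ?_) g
  · simpa using h
  · rw [← Equiv.sum_comp (Equiv.mulLeft r)]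
    refine sum_congr rfl fun h _ => ?_
    simp [symCoeff_row_mul hr, mul_assoc]
  · rw [mul_sum]
    refine sum_congr rfl fun h _ => ?_
    rw [← mul_assoc, symCoeff_mul_col hk]
    ring

theorem symCoeff_conv_one (ν : n.Partition) (g : Perm (Fin n)) :
    ∑ h, symCoeff ν h * symCoeff ν (h⁻¹ * g) = symScalar ν * symCoeff ν g := by
  simpa [symScalar] using symCoeff_conv ν 1 g

theorem youngSymmetrizer_mul_self (ν : n.Partition) :
    youngSymmetrizer ν * youngSymmetrizer ν = symScalar ν • youngSymmetrizer ν := by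
  ext g
  rw [coeff_mul_eq_sum]
  exact symCoeff_conv_one ν g

/-- If `c² = 0`, right multiplication by `c` is nilpotent and has trace zero; but its trace is `n!`
times the coefficient of `c` at the identity, which is `1`. -/
theorem symScalar_ne_zero (ν : n.Partition) : symScalar ν ≠ 0 := by
  intro h0
  have hsq := youngSymmetrizer_mul_self ν
  rw [h0, zero_smul] at hsq
  have hnil : IsNilpotent (LinearMap.mulLeft ℂ (MonoidAlgebra.of ℂ (Perm (Fin n)) 1) ∘ₗ
      LinearMap.mulRight ℂ (youngSymmetrizer ν)) := by
    refine ⟨2, ?_⟩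
    refine LinearMap.ext fun x => ?_
    simp only [pow_two, Module.End.mul_apply, LinearMap.comp_apply, LinearMap.mulLeft_apply,
      LinearMap.mulRight_apply, map_one, one_mul, mul_assoc, hsq, mul_zero, LinearMap.zero_apply]
  have h := LinearMap.isNilpotent_trace_of_isNilpotent hnil
  rw [trace_mulLeft_mulRight, isNilpotent_iff_eq_zero] at h
  have h1 : ∀ x : Perm (Fin n), (youngSymmetrizer ν).coeff (x⁻¹ * 1⁻¹ * x) = 1 := by
    intro x
    rw [inv_one, mul_one, inv_mul_cancel]
    exact symCoeff_one ν
  simp only [h1] at h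
  simp [ Fintype.card_perm, Nat.factorial_ne_zero] at h

/-- The character of the Specht module. -/
def spechtChar (ν : n.Partition) (g : Perm (Fin n)) : ℂ := (spechtRep ν).character g

/-- The rescaled symmetrizer `e` is an idempotent generating the Specht ideal. The map `x ↦ g x e`
has image in the ideal and acts on it as `g`, so its trace on the whole group algebra is the
character. -/
theorem spechtChar_eq (ν : n.Partition) (g : Perm (Fin n)) :
    spechtChar ν g = (symScalar ν)⁻¹ * ∑ x, symCoeff ν (x⁻¹ * g⁻¹ * x) := by
  set e : MonoidAlgebra ℂ (Perm (Fin n)) := (symScalar ν)⁻¹ • youngSymmetrizer ν with he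
  set f := LinearMap.mulLeft ℂ (MonoidAlgebra.of ℂ (Perm (Fin n)) g) ∘ₗ
    LinearMap.mulRight ℂ e with hf
  set p : Submodule ℂ (MonoidAlgebra ℂ (Perm (Fin n))) := (specht ν).restrictScalars ℂ with hp
  have hfp : ∀ x, f x ∈ p := by
    intro x
    have : f x = (MonoidAlgebra.of ℂ (Perm (Fin n)) g * x *
        algebraMap ℂ _ (symScalar ν)⁻¹) * youngSymmetrizer ν := by
      simp [hf, he, mul_assoc, Algebra.algebraMap_eq_smul_one]
    rw [this]
    exact Ideal.mul_mem_left _ _ (Ideal.subset_span rfl)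
  have hfix : ∀ x ∈ p, x * e = x := by
    intro x hx
    obtain ⟨y, rfl⟩ := Ideal.mem_span_singleton'.1 (show x ∈ specht ν from hx)
    rw [he, mul_smul_comm, mul_assoc, youngSymmetrizer_mul_self, mul_smul_comm, smul_smul,
      inv_mul_cancel₀ (symScalar_ne_zero ν), one_smul]
  have htr := LinearMap.trace_restrict_eq_of_forall_mem p f hfp
  have hrep : spechtRep ν g = f.restrict (p := p) (q := p) (fun x _ => hfp x) := by
    refine LinearMap.ext fun x => Subtype.ext ?_
    have h1 : f (x : MonoidAlgebra ℂ (Perm (Fin n))) = MonoidAlgebra.of ℂ _ g * x := by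
      rw [hf, LinearMap.comp_apply, LinearMap.mulRight_apply, LinearMap.mulLeft_apply,
        hfix x x.2]
    exact h1.symm
  rw [spechtChar, Representation.character, hrep]
  refine htr.trans ?_
  rw [hf, trace_mulLeft_mulRight, mul_sum]
  refine sum_congr rfl fun x _ => ?_
  rw [he, MonoidAlgebra.coeff_smul_apply, smul_eq_mul]
  rfl

theorem spechtChar_conj (ν : n.Partition) (x g : Perm (Fin n)) :
    spechtChar ν (x * g * x⁻¹) = spechtChar ν g := by
  rw [spechtChar_eq, spechtChar_eq, ← Equiv.sum_comp (Equiv.mulLeft x)]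
  simp [mul_assoc]

theorem spechtChar_of_cycleType_eq (ν : n.Partition) {g h : Perm (Fin n)}
    (hgh : g.cycleType = h.cycleType) : spechtChar ν g = spechtChar ν h := by
  obtain ⟨x, hx⟩ := isConj_iff.1 (Perm.isConj_iff_cycleType_eq.2 hgh)
  rw [← hx, spechtChar_conj]

theorem spechtChar_inv (ν : n.Partition) (g : Perm (Fin n)) :
    spechtChar ν g⁻¹ = spechtChar ν g :=
  spechtChar_of_cycleType_eq ν (Perm.cycleType_inv g)

theorem star_spechtChar (ν : n.Partition) (g : Perm (Fin n)) :
    star (spechtChar ν g) = spechtChar ν g := by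
  have h : star (symScalar ν) = symScalar ν := by
    simp only [symScalar, star_sum, star_mul', star_symCoeff]
  rw [spechtChar_eq, star_mul', star_inv₀, h, star_sum]
  simp only [star_symCoeff]

/-- The character is an average of conjugates of the symmetrizer, and `φ` does not see conjugation
or inversion. Pairings with `χ` thus reduce to pairings with the symmetrizer. -/
theorem sum_spechtChar_mul (ν : n.Partition) (φ : Perm (Fin n) → ℂ)
    (hφ : ∀ x g, φ (x * g * x⁻¹) = φ g) (hφ' : ∀ g, φ g⁻¹ = φ g) :
    ∑ g, spechtChar ν g * φ g =
      n.factorial * ((symScalar ν)⁻¹ * ∑ g, symCoeff ν g * φ g) := by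
  simp_rw [spechtChar_eq, mul_assoc, sum_mul, ← mul_sum]
  rw [sum_comm, mul_left_comm]
  congr 1
  have h : ∀ x : Perm (Fin n), ∑ g, symCoeff ν (x⁻¹ * (g⁻¹ * x)) * φ g =
      ∑ g, symCoeff ν g * φ g := by
    intro x
    rw [← Equiv.sum_comp (Equiv.inv (Perm (Fin n))), ← Equiv.sum_comp (MulAut.conj x).toEquiv]
    refine sum_congr rfl fun g _ => ?_
    have h1 : φ ((MulAut.conj x) g)⁻¹ = φ g := by rw [hφ', MulAut.conj_apply, hφ]
    simp only [MulEquiv.toEquiv_eq_coe, EquivLike.coe_coe, Equiv.inv_apply, h1]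
    simp [mul_assoc]
  simp [h, Fintype.card_perm]

/-- Pairing `χ` with the symmetrizer needs the coefficient of `c x c` at `x`, summed over `x`.
Applying `symCoeff_conv` and then `c² = m c` evaluates this to `m²`, which cancels both normalizing
factors `m⁻¹`. -/
theorem sum_spechtChar_sq (ν : n.Partition) :
    ∑ g, spechtChar ν g * spechtChar ν g = n.factorial := by
  rw [sum_spechtChar_mul ν _ (spechtChar_conj ν) (spechtChar_inv ν)]
  have h : ∑ g, symCoeff ν g * ∑ x, symCoeff ν (x⁻¹ * g⁻¹ * x) = symScalar ν * symScalar ν := by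
    calc ∑ g, symCoeff ν g * ∑ x, symCoeff ν (x⁻¹ * g⁻¹ * x)
        = ∑ x, ∑ g, symCoeff ν g * symCoeff ν (x⁻¹ * g⁻¹ * x) := by
          simp_rw [mul_sum]
          rw [sum_comm]
      _ = ∑ g, symCoeff ν g * ∑ x, symCoeff ν x * symCoeff ν (x⁻¹ * g⁻¹) := by
          simp_rw [symCoeff_conv, sum_mul, mul_sum]
          rw [sum_comm]
          exact sum_congr rfl fun _ _ => sum_congr rfl fun _ _ => by ring
      _ = symScalar ν * symScalar ν := by
          simp_rw [symCoeff_conv_one]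
          conv_rhs => enter [2]; rw [symScalar]
          rw [mul_sum]
          exact sum_congr rfl fun _ _ => by ring
  have h' : ∑ g, symCoeff ν g * spechtChar ν g = symScalar ν := by
    simp_rw [spechtChar_eq, mul_left_comm (symCoeff ν _), ← mul_sum, h]
    rw [inv_mul_cancel_left₀ (symScalar_ne_zero ν)]
  rw [h', inv_mul_cancel₀ (symScalar_ne_zero ν), mul_one]

end

end MarinoVafa

namespace MarinoVafa

noncomputable section

open Finset Equiv

variable {n : ℕ}

/-! ### Pairing the Young symmetrizer with fillings -/

instance (ν : n.Partition) (t : Fin n → ℕ) : Decidable (ColInj ν t) := by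
  unfold ColInj
  infer_instance

theorem card_row (ν : n.Partition) (i : ℕ) : #{k | rowIdx ν k = i} = (diagram ν).rowLen i := by
  rw [← card_range ((diagram ν).rowLen i)]
  refine card_nbij (colIdx ν) ?_ ?_ ?_
  · intro k hk
    have h := YoungDiagram.mem_iff_lt_rowLen.1 (rowIdx_colIdx_mem ν k)
    rw [(mem_filter.1 hk).2] at h
    simpa using h
  · intro k hk l hl h
    exact eq_of_rowIdx_colIdx ((mem_filter.1 hk).2.trans (mem_filter.1 hl).2.symm) h
  · intro j hj
    obtain ⟨k, h1, h2⟩ := exists_rowIdx_colIdx ν (i := i) (j := j)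
      (YoungDiagram.mem_iff_lt_rowLen.2 (mem_range.1 hj))
    exact ⟨k, by simp [h1], h2⟩

theorem rowIdx_lt (ν : n.Partition) (k : Fin n) : rowIdx ν k < n := by
  refine lt_of_lt_of_le (rowIdx_lt_colLen ν k) ?_
  rw [← card_column]
  exact (card_le_univ _).trans_eq (Fintype.card_fin n)

theorem card_val_lt_eq_sum {N : ℕ} (t : Fin n → Fin N) (i : Fin N) :
    #{k | (t k : ℕ) < i + 1} = ∑ j ∈ Iic i, #{k | t k = j} := by
  rw [card_eq_sum_card_fiberwise (f := t) (t := Iic i)]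
  · refine sum_congr rfl fun j hj => ?_
    congr 1
    ext k
    simp only [mem_filter, mem_univ, true_and, and_iff_right_iff_imp]
    rintro rfl
    have := Fin.le_def.1 (mem_Iic.1 hj)
    omega
  · intro k hk
    have := (mem_filter.1 hk).2
    simp only [coe_Iic, Set.mem_Iic, Fin.le_def]
    omega

/-- The filling of the tableau whose entry in each cell is the row of the cell. -/
def rowFill (ν : n.Partition) {N : ℕ} (hN : n ≤ N) (k : Fin n) : Fin N :=
  ⟨rowIdx ν k, (rowIdx_lt ν k).trans_le hN⟩

theorem card_rowFill (ν : n.Partition) {N : ℕ} (hN : n ≤ N) (i : Fin N) :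
    #{k | rowFill ν hN k = i} = (diagram ν).rowLen i := by
  rw [← card_row]
  simp [rowFill, Fin.ext_iff]

/-- A column-injective filling whose content differs from the shape `ν` by a permutation of the
staircase has content `ν`. -/
theorem ColInj.perm_eq_one {ν : n.Partition} {N : ℕ} (hN : n ≤ N) {t : Fin n → Fin N}
    (ht : ColInj ν fun k => t k) {π : Perm (Fin N)}
    (h : ∀ i, #{k | t k = i} + (Fin.rev (π i) : ℕ) = (diagram ν).rowLen i + (Fin.rev i : ℕ)) :
    π = 1 := by
  have h' : ∀ i, #{k | t k = i} + (i : ℕ) = (diagram ν).rowLen i + (π i : ℕ) := by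
    intro i
    have h1 := h i
    rw [Fin.val_rev, Fin.val_rev] at h1
    omega
  -- Dominance bounds the partial sums of the content of `t` by those of `ν`; by `h'` the deficit is
  -- the difference of these two sums.
  have key : ∀ i : Fin N, ∑ j ∈ Iic i, (π j : ℕ) ≤ ∑ j ∈ Iic i, (j : ℕ) := by
    intro i
    have h1 : ∑ j ∈ Iic i, (#{k | t k = j} + (j : ℕ)) =
        ∑ j ∈ Iic i, ((diagram ν).rowLen j + (π j : ℕ)) := sum_congr rfl fun j _ => h' j
    have h2 := ht.card_lt_le (i + 1)
    have h3 := card_val_lt_eq_sum (rowFill ν hN) i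
    simp only [card_rowFill] at h3
    rw [sum_add_distrib, sum_add_distrib, ← h3, ← card_val_lt_eq_sum] at h1
    change _ ≤ #{k | (rowFill ν hN k : ℕ) < i + 1} at h2
    omega
  ext1 i
  induction i using WellFoundedLT.induction with
  | ind i ih =>
    have h1 := key i
    rw [← Iio_insert, sum_insert (by simp), sum_insert (by simp),
      sum_congr rfl fun j hj => congrArg Fin.val (ih j (mem_Iio.1 hj))] at h1
    simp only [Perm.one_apply, add_le_add_iff_right] at h1
    -- If `π i < i`, the value `π i` is already fixed by `π`, contradicting injectivity.
    refine le_antisymm (Fin.le_def.2 h1) (le_of_not_gt fun h2 => ?_)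
    have h3 := π.injective (ih _ h2)
    exact absurd h3 h2.ne

/-- Right multiplication by the transposition of two equal entries in a column preserves the
stabilizer of `t` and changes the sign of the symmetrizer's coefficient. -/
theorem sum_symCoeff_fix_eq_zero {ν : n.Partition} {α : Type*} [DecidableEq α] {t : Fin n → α}
    (ht : ¬ ∀ k l, colIdx ν k = colIdx ν l → t k = t l → k = l) :
    ∑ g, symCoeff ν g * (if ∀ k, t (g k) = t k then 1 else 0) = 0 := by
  simp only [not_forall] at ht
  obtain ⟨p, q, h1, h2, h3⟩ := ht
  have hC : swap p q ∈ colStab ν := by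
    rw [mem_colStab]
    intro k
    rw [swap_apply_def]
    split_ifs with ha hb
    · rw [ha, h1]
    · rw [hb, h1]
    · rfl
  have ht' : ∀ k, t (swap p q k) = t k := by
    intro k
    rw [swap_apply_def]
    split_ifs with ha hb
    · rw [ha, h2]
    · rw [hb, h2]
    · rfl
  refine self_eq_neg.1 ?_
  conv_lhs => rw [← Equiv.sum_comp (Equiv.mulRight (swap p q))]
  rw [← sum_neg_distrib]
  refine sum_congr rfl fun g _ => ?_
  have h4 : (∀ k, t ((g * swap p q) k) = t k) ↔ ∀ k, t (g k) = t k := by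
    refine ⟨fun h k => ?_, fun h k => ?_⟩
    · have := h (swap p q k)
      rwa [Perm.mul_apply, swap_apply_self, ht'] at this
    · rw [Perm.mul_apply, h, ht']
  simp only [coe_mulRight, symCoeff_mul_col hC, Perm.sign_swap h3, h4]
  split_ifs <;> simp

/-- These fillings are the row filling composed with a column permutation `k`, whose stabilizer is
the conjugate `k⁻¹ R k` of the row group `R`. By the column rule its contribution is `sgn k ∑_r
c(k⁻¹ r)`, and summing over `k` gives the scalar of `c²`. -/
theorem sum_symCoeff_rowFill (ν : n.Partition) {N : ℕ} (hN : n ≤ N) :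
    ∑ t : Fin n → Fin N with (ColInj ν fun k => t k) ∧
        ∀ i : Fin N, #{k | t k = i} = (diagram ν).rowLen i,
      ∑ g, symCoeff ν g * (if ∀ k, t (g k) = t k then 1 else 0) = symScalar ν := by
  classical
  have h1 : symScalar ν = ∑ k ∈ colStab ν, ∑ r ∈ rowStab ν,
      ((Perm.sign k : ℤ) : ℂ) * symCoeff ν (k⁻¹ * r) := by
    rw [symScalar, sum_symCoeff_mul, sum_comm]
    refine sum_congr rfl fun k _ => ?_
    refine sum_bij' (fun s _ => s⁻¹) (fun s _ => s⁻¹) (fun s hs => inv_mem_rowStab hs)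
      (fun s hs => inv_mem_rowStab hs) (by simp) (by simp) fun s _ => ?_
    simp
  rw [h1]
  symm
  refine sum_bij (fun k _ => rowFill ν hN ∘ k) ?_ ?_ ?_ ?_
  · intro σ hσ
    rw [mem_colStab] at hσ
    simp only [mem_filter, mem_univ, true_and, Function.comp_apply]
    refine ⟨fun k l hkl h => ?_, fun i => ?_⟩
    · exact σ.injective (eq_of_rowIdx_colIdx h (by rw [hσ, hσ, hkl]))
    · rw [← card_rowFill ν hN]
      exact card_equiv σ fun k => by simp
  · intro σ hσ τ hτ h
    rw [mem_colStab] at hσ hτ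
    ext1 k
    exact eq_of_rowIdx_colIdx (congrArg Fin.val (congrFun h k)) (by rw [hσ, hτ])
  · intro t ht
    obtain ⟨h2, h3⟩ := (mem_filter.1 ht).2
    obtain ⟨σ, h4, h5⟩ := h2.exists_perm fun K => by
      have aux : ∀ s : Fin n → Fin N, (∀ i, #{k | s k = i} = (diagram ν).rowLen i) →
          #{k | (s k : ℕ) < K} = ∑ i : Fin N with i.1 < K, (diagram ν).rowLen i := by
        intro s hs
        rw [card_eq_sum_card_fiberwise (f := s) (t := ({i : Fin N | i.1 < K} : Finset _))]
        · refine sum_congr rfl fun j hj => ?_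
          rw [← hs]
          congr 1
          ext k
          simp only [mem_filter, mem_univ, true_and, and_iff_right_iff_imp]
          rintro rfl
          exact (mem_filter.1 hj).2
        · intro k hk
          simpa using hk
      exact (aux t h3).trans (aux (rowFill ν hN) (card_rowFill ν hN)).symm
    exact ⟨σ, mem_colStab.2 h4, funext fun k => Fin.ext (h5 k)⟩
  · intro σ hσ
    rw [← Equiv.sum_comp (MulAut.conj σ⁻¹).toEquiv]
    simp only [mul_ite, mul_one, mul_zero]
    rw [← sum_filter]
    symm
    refine sum_congr ?_ fun g _ => ?_
    · ext g
      simp only [mem_filter, mem_univ, true_and, mem_rowStab]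
      have h : ∀ k, (MulAut.conj σ⁻¹ g) k = σ⁻¹ (g (σ k)) := fun k => by simp
      simp only [MulEquiv.toEquiv_eq_coe, EquivLike.coe_coe, Function.comp_apply, h, rowFill,
        Fin.mk.injEq]
      simp only [Perm.inv_def, apply_symm_apply]
      exact ⟨fun h k => by simpa using h (σ.symm k), fun h k => h (σ k)⟩
    · simp only [MulEquiv.toEquiv_eq_coe, EquivLike.coe_coe, MulAut.conj_apply, inv_inv]
      rw [symCoeff_mul_col hσ]

/-- The strictly decreasing sequence `ν_i + N - i`, where `N` is the number of variables. -/
def shifted (ν : n.Partition) {N : ℕ} (i : Fin N) : ℕ := (diagram ν).rowLen i + (Fin.rev i : ℕ)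

/-- The value of the alternating sum `∑_π sgn(π) ψ_{ν + δ - π(δ)}` of permutation characters. -/
def altChar (N : ℕ) (ν : n.Partition) (g : Perm (Fin n)) : ℤ :=
  ∑ π : Perm (Fin N), (Perm.sign π : ℤ) * #{t : Fin n → Fin N | (∀ k, t (g k) = t k) ∧
    ∀ i, #{k | t k = i} + (Fin.rev (π i) : ℕ) = shifted ν i}

/-- Fillings with a repetition in a column cancel by `sum_symCoeff_fix_eq_zero`; the remaining ones
occur only for the identity, by `ColInj.perm_eq_one`. -/
theorem sum_symCoeff_altChar (ν : n.Partition) {N : ℕ} (hN : n ≤ N) :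
    ∑ g, symCoeff ν g * altChar N ν g = symScalar ν := by
  have h1 : ∀ g, symCoeff ν g * (altChar N ν g : ℂ) = ∑ π : Perm (Fin N),
      ∑ t : Fin n → Fin N with ∀ i, #{k | t k = i} + (Fin.rev (π i) : ℕ) = shifted ν i,
      ((Perm.sign π : ℤ) : ℂ) * (symCoeff ν g * (if ∀ k, t (g k) = t k then 1 else 0)) := by
    intro g
    rw [altChar, Int.cast_sum, mul_sum]
    refine sum_congr rfl fun π _ => ?_
    rw [← mul_sum, ← mul_sum, ← sum_filter, filter_filter]
    push_cast
    simp only [and_comm, sum_const, nsmul_eq_mul, mul_one]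
    ring
  simp_rw [h1]
  rw [sum_comm, sum_eq_single_of_mem 1 (mem_univ _)]
  · rw [sum_comm, ← sum_symCoeff_rowFill ν hN]
    simp only [Perm.sign_one, Units.val_one, Int.cast_one, one_mul, shifted, Perm.one_apply,
      add_left_inj]
    symm
    classical
    refine sum_subset (fun t ht => ?_) fun t ht ht' => ?_
    · have := (mem_filter.1 ht).2.2
      simpa using this
    · refine sum_symCoeff_fix_eq_zero fun h => ht' ?_
      simp only [mem_filter, mem_univ, true_and] at ht ⊢
      exact ⟨fun k l h1 h2 => h k l h1 (Fin.ext h2), ht⟩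
  · intro π _ hπ
    rw [sum_comm]
    refine sum_eq_zero fun t ht => ?_
    rw [← mul_sum, sum_symCoeff_fix_eq_zero, mul_zero]
    intro h
    exact hπ (ColInj.perm_eq_one hN (fun k l h1 h2 => h k l h1 (Fin.ext h2)) (mem_filter.1 ht).2)

theorem altChar_conj (N : ℕ) (ν : n.Partition) (x g : Perm (Fin n)) :
    altChar N ν (x * g * x⁻¹) = altChar N ν g := by
  refine sum_congr rfl fun π _ => ?_
  congr 2
  refine card_equiv (x.symm.arrowCongr (Equiv.refl _)) fun t => ?_
  have h1 : ∀ k, (x.symm.arrowCongr (Equiv.refl (Fin N))) t k = t (x k) := fun k => by simp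
  have h2 : ∀ i, #{k | t (x k) = i} = #{k | t k = i} :=
    fun i => card_equiv x fun k => by simp
  rw [mem_filter, mem_filter]
  simp only [mem_univ, true_and, h1, h2, and_congr_left_iff, Perm.mul_apply]
  refine fun _ => ⟨fun h k => ?_, fun h k => ?_⟩
  · simpa using h (x k)
  · simpa using h (x⁻¹ k)

theorem altChar_inv (N : ℕ) (ν : n.Partition) (g : Perm (Fin n)) :
    altChar N ν g⁻¹ = altChar N ν g := by
  refine sum_congr rfl fun π _ => ?_
  have h : ∀ t : Fin n → Fin N, (∀ k, t (g⁻¹ k) = t k) ↔ ∀ k, t (g k) = t k := by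
    refine fun t => ⟨fun h k => ?_, fun h k => ?_⟩
    · rw [← h (g k)]; simp
    · rw [← h (g⁻¹ k)]; simp
  simp only [h]

theorem sum_spechtChar_altChar (ν : n.Partition) {N : ℕ} (hN : n ≤ N) :
    ∑ g, spechtChar ν g * altChar N ν g = n.factorial := by
  rw [sum_spechtChar_mul ν (fun g => (altChar N ν g : ℂ)) (fun x g => by rw [altChar_conj])
    (fun g => by rw [altChar_inv]), sum_symCoeff_altChar ν hN,
    inv_mul_cancel₀ (symScalar_ne_zero ν), mul_one]

end

end MarinoVafa

namespace MarinoVafa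

noncomputable section

open Finset Equiv

/-! ### Fillings fixed by permutations -/

/-- The number of times each value is taken. -/
def content {α ι : Type*} [Fintype α] [DecidableEq ι] (s : α → ι) (i : ι) : ℕ := #{k | s k = i}

theorem content_comp {α ι : Type*} [Fintype α] [DecidableEq ι] (s : α → ι) (g : Perm α) :
    content (s ∘ g) = content s :=
  funext fun _ => card_equiv g fun k => by simp

theorem sum_content {α ι : Type*} [Fintype α] [Fintype ι] [DecidableEq ι] (s : α → ι) :
    ∑ i, content s i = Fintype.card α := by
  rw [← card_univ, card_eq_sum_card_fiberwise (f := s) (t := univ) (by simp)]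
  rfl

theorem exists_content_eq {n : ℕ} {ι : Type*} [Fintype ι] [DecidableEq ι] {A : ι → ℕ}
    (hA : ∑ i, A i = n) : ∃ s : Fin n → ι, content s = A := by
  have e : Fin n ≃ Σ i, Fin (A i) := Fintype.equivOfCardEq (by simp [hA])
  refine ⟨fun k => (e k).1, funext fun i => ?_⟩
  rw [content, ← Fintype.card_fin (A i), ← card_univ]
  symm
  refine card_nbij (fun a => e.symm ⟨i, a⟩) (fun a _ => by simp) (fun a _ b _ h => ?_) ?_
  · simpa using h
  · intro k hk
    have hk' : (e k).1 = i := by simpa using hk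
    subst hk'
    exact ⟨(e k).2, by simp, by simp⟩

theorem exists_comp_eq_of_content_eq {α ι : Type*} [Fintype α] [DecidableEq ι] {s t : α → ι}
    (h : content s = content t) : ∃ g : Perm α, t ∘ g = s := by
  have e : ∀ c, {a // s a = c} ≃ {a // t a = c} := fun c => Fintype.equivOfCardEq (by
    simpa [content, Fintype.card_subtype] using congrFun h c)
  exact ⟨Equiv.ofFiberEquiv e, funext fun a => Equiv.ofFiberEquiv_map e a⟩

/-- Orbit-stabilizer: the fillings of a given content form one orbit of the symmetric group. -/
theorem sum_card_stabilizer {n : ℕ} {ι : Type*} [Fintype ι] [DecidableEq ι] {A : ι → ℕ}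
    (hA : ∑ i, A i = n) :
    ∑ s : Fin n → ι with content s = A, #{g : Perm (Fin n) | s ∘ g = s} = n.factorial := by
  obtain ⟨s₀, hs₀⟩ := exists_content_eq hA
  have h1 : ∀ s ∈ ({s : Fin n → ι | content s = A} : Finset _),
      #{g : Perm (Fin n) | s ∘ g = s} = #{g : Perm (Fin n) | s₀ ∘ g = s} := by
    intro s hs
    obtain ⟨h, rfl⟩ := exists_comp_eq_of_content_eq (((mem_filter.1 hs).2).trans hs₀.symm)
    refine card_equiv (Equiv.mulLeft h) fun g => ?_
    rw [mem_filter, mem_filter]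
    simp [Function.comp_assoc]
  rw [sum_congr rfl h1, ← card_eq_sum_card_fiberwise (f := fun g : Perm (Fin n) => s₀ ∘ g)]
  · simp [Fintype.card_perm]
  · intro g _
    simp [content_comp, hs₀]

/-- Summing a function of the content over all pairs of a permutation and a filling fixed by it. -/
theorem sum_fixed_fillings {n : ℕ} {ι M : Type*} [Fintype ι] [DecidableEq ι] [AddCommMonoid M]
    (W : (ι → ℕ) → M) :
    ∑ g : Perm (Fin n), ∑ s : Fin n → ι with s ∘ g = s, W (content s) =
      n.factorial • ∑ A ∈ univ.piAntidiag n, W A := by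
  simp_rw [sum_filter]
  rw [sum_comm, smul_sum,
    ← sum_fiberwise_of_maps_to (g := content) (t := (univ : Finset ι).piAntidiag n)]
  · refine sum_congr rfl fun A hA => ?_
    have hA' : ∑ i, A i = n := (mem_piAntidiag.1 hA).1
    rw [← sum_card_stabilizer hA', ← sum_nsmul_assoc]
    refine sum_congr rfl fun s hs => ?_
    rw [(mem_filter.1 hs).2, ← sum_filter, sum_const]
  · intro s _
    rw [mem_piAntidiag]
    exact ⟨by simp [sum_content], by simp⟩

/-! ### Alternants and the Jacobi-Trudi identity -/

open MvPolynomial in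
/-- The alternant `det (x_i ^ {e_j})`. -/
def alternant {N : ℕ} (e : Fin N → ℕ) : MvPolynomial (Fin N) ℤ :=
  (Matrix.of fun i j => (X i : MvPolynomial (Fin N) ℤ) ^ e j).det

/-- The generating series `∏_i 1 / (1 - x_i T)` of the complete homogeneous polynomials. -/
def completeSeries (N : ℕ) : PowerSeries (MvPolynomial (Fin N) ℤ) :=
  ∏ i, PowerSeries.mk fun a => (MvPolynomial.X i : MvPolynomial (Fin N) ℤ) ^ a

theorem one_sub_mul_mk_pow {A : Type*} [CommRing A] (x : A) :
    (1 - PowerSeries.C x * PowerSeries.X) * PowerSeries.mk (fun a => x ^ a) = 1 := by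
  ext a
  rw [sub_mul, one_mul, map_sub, mul_assoc, PowerSeries.coeff_C_mul]
  cases a with
  | zero => simp
  | succ a => simp [PowerSeries.coeff_succ_X_mul, pow_succ', PowerSeries.coeff_one]

theorem constantCoeff_completeSeries (N : ℕ) :
    PowerSeries.constantCoeff (completeSeries N) = 1 := by
  rw [completeSeries, map_prod]
  exact prod_eq_one fun i _ => by rw [← PowerSeries.coeff_zero_eq_constantCoeff_apply]; simp

/-- The matrix of the signed elementary symmetric polynomials omitting one variable. -/
def omitMatrix (N : ℕ) : Matrix (Fin N) (Fin N) (MvPolynomial (Fin N) ℤ) :=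
  Matrix.of fun i k => (∏ p ∈ univ.erase i,
    (1 - Polynomial.C (MvPolynomial.X p : MvPolynomial (Fin N) ℤ) * Polynomial.X)).coeff
      (Fin.rev k)

/-- The Jacobi-Trudi matrix `h_{e_j - δ_k}`. -/
def jacobiTrudi {N : ℕ} (e : Fin N → ℕ) : Matrix (Fin N) (Fin N) (MvPolynomial (Fin N) ℤ) :=
  Matrix.of fun k j => PowerSeries.coeff (e j)
    (PowerSeries.X ^ (Fin.rev k : ℕ) * completeSeries N)

/-- Multiplying `∏ 1/(1 - x_p T)` by the factors `1 - x_p T` with `p ≠ i` leaves `1/(1 - x_i T)`;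
the entries are its coefficients. With `N - 1` factors, the polynomial has degree below `N` and fits
in one row. -/
theorem omitMatrix_mul_jacobiTrudi {N : ℕ} (e : Fin N → ℕ) :
    omitMatrix N * jacobiTrudi e =
      Matrix.of fun i j => (MvPolynomial.X i : MvPolynomial (Fin N) ℤ) ^ e j := by
  ext1 i j
  set E : Polynomial (MvPolynomial (Fin N) ℤ) := ∏ p ∈ univ.erase i,
    (1 - Polynomial.C (MvPolynomial.X p : MvPolynomial (Fin N) ℤ) * Polynomial.X) with hE
  have hdeg : E.natDegree < N := by
    have h1 : E.natDegree ≤ ∑ p ∈ univ.erase i, 1 := by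
      refine (Polynomial.natDegree_prod_le _ _).trans (sum_le_sum fun p _ => ?_)
      compute_degree
    have h2 := i.pos
    rw [sum_const, card_erase_of_mem (mem_univ _), card_univ, Fintype.card_fin, smul_eq_mul,
      mul_one] at h1
    omega
  have hsum : (E : PowerSeries (MvPolynomial (Fin N) ℤ)) = ∑ k : Fin N,
      PowerSeries.C (E.coeff (Fin.rev k)) * PowerSeries.X ^ (Fin.rev k : ℕ) := by
    conv_lhs => rw [E.as_sum_range_C_mul_X_pow' hdeg]
    rw [sum_range, ← Equiv.sum_comp Fin.revPerm, ← Polynomial.coeToPowerSeries.ringHom_apply,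
      map_sum]
    simp
  have hprod : (E : PowerSeries (MvPolynomial (Fin N) ℤ)) * completeSeries N =
      PowerSeries.mk fun a => (MvPolynomial.X i : MvPolynomial (Fin N) ℤ) ^ a := by
    have h1 : (E : PowerSeries (MvPolynomial (Fin N) ℤ)) = ∏ p ∈ univ.erase i,
        (1 - PowerSeries.C (MvPolynomial.X p : MvPolynomial (Fin N) ℤ) * PowerSeries.X) := by
      rw [hE, ← Polynomial.coeToPowerSeries.ringHom_apply, map_prod]
      simp
    rw [h1, completeSeries, ← mul_prod_erase univ _ (mem_univ i), mul_left_comm,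
      ← prod_mul_distrib, prod_congr rfl fun p _ => one_sub_mul_mk_pow _, prod_const_one, mul_one]
  have h2 := congrArg (PowerSeries.coeff (e j)) hprod
  rw [hsum, sum_mul, map_sum, PowerSeries.coeff_mk] at h2
  rw [Matrix.mul_apply, Matrix.of_apply, ← h2]
  refine sum_congr rfl fun k _ => ?_
  rw [mul_assoc, PowerSeries.coeff_C_mul]
  rfl

/-- For the staircase the matrix is unitriangular. This identifies the determinant of `omitMatrix`
with the staircase alternant, whatever the exponents `e` on the other side. -/
theorem det_jacobiTrudi_rev (N : ℕ) :
    (jacobiTrudi fun j : Fin N => (Fin.rev j : ℕ)).det = 1 := by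
  rw [Matrix.det_of_isLowerTriangular]
  · refine prod_eq_one fun i _ => ?_
    rw [jacobiTrudi, Matrix.of_apply, PowerSeries.coeff_X_pow_mul', if_pos le_rfl, Nat.sub_self,
      PowerSeries.coeff_zero_eq_constantCoeff_apply, constantCoeff_completeSeries]
  · intro k j hkj
    rw [jacobiTrudi, Matrix.of_apply, PowerSeries.coeff_X_pow_mul', if_neg]
    rw [not_le, Fin.val_fin_lt, Fin.rev_lt_rev]
    exact hkj

theorem alternant_eq_mul_det_jacobiTrudi {N : ℕ} (e : Fin N → ℕ) :
    alternant e = alternant (fun j => (Fin.rev j : ℕ)) * (jacobiTrudi e).det := by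
  have h := fun e : Fin N → ℕ => congrArg Matrix.det (omitMatrix_mul_jacobiTrudi e)
  simp only [Matrix.det_mul] at h
  have h1 := h fun j => (Fin.rev j : ℕ)
  rw [det_jacobiTrudi_rev, mul_one] at h1
  rw [alternant, alternant, ← h, ← h1]

end

end MarinoVafa

namespace MarinoVafa

noncomputable section

open Finset Equiv

variable {n : ℕ}

/-! ### Frobenius' formula -/

/-- The monomial with exponents `e`. -/
def monom {N : ℕ} (e : Fin N → ℕ) : MvPolynomial (Fin N) ℤ :=
  MvPolynomial.monomial (Finsupp.equivFunOnFinite.symm e) 1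

theorem monom_eq_prod {N : ℕ} (e : Fin N → ℕ) : monom e = ∏ i, MvPolynomial.X i ^ e i := by
  rw [monom, MvPolynomial.monomial_eq, map_one, one_mul, Finsupp.prod_fintype _ _ (by simp)]
  simp

theorem monom_mul_monom {N : ℕ} (e f : Fin N → ℕ) : monom e * monom f = monom (e + f) := by
  simp only [monom_eq_prod, ← prod_mul_distrib, Pi.add_apply, pow_add]

/-- The coefficient at the monomial with exponents `e`. -/
def coeffAt {N : ℕ} (e : Fin N → ℕ) : MvPolynomial (Fin N) ℤ →ₗ[ℤ] ℤ :=
  MvPolynomial.lcoeff ℤ (Finsupp.equivFunOnFinite.symm e)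

theorem coeffAt_monom {N : ℕ} (e f : Fin N → ℕ) :
    coeffAt e (monom f) = if f = e then 1 else 0 := by
  rw [coeffAt, MvPolynomial.lcoeff_apply, monom, MvPolynomial.coeff_monomial]
  simp

theorem alternant_eq_sum {N : ℕ} (e : Fin N → ℕ) :
    alternant e = ∑ π : Perm (Fin N), (Perm.sign π : ℤ) • monom (e ∘ π) := by
  rw [alternant, ← Matrix.det_transpose, Matrix.det_apply]
  refine sum_congr rfl fun π _ => ?_
  rw [monom_eq_prod, Units.smul_def]
  rfl

theorem prod_X_eq_monom_content {N : ℕ} (t : Fin n → Fin N) :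
    ∏ k, (MvPolynomial.X (t k) : MvPolynomial (Fin N) ℤ) = monom (content t) := by
  rw [monom_eq_prod, ← prod_fiberwise_of_maps_to (g := t) (t := univ) (by simp)]
  refine prod_congr rfl fun i _ => ?_
  rw [content, ← prod_const]
  exact prod_congr rfl fun k hk => by rw [(mem_filter.1 hk).2]

/-- The sum of the monomials of the fillings fixed by `g`, i.e. the product of the power sums
attached to the cycles of `g`. -/
def cyclePoly (N : ℕ) (g : Perm (Fin n)) : MvPolynomial (Fin N) ℤ :=
  ∑ t : Fin n → Fin N with t ∘ g = t, monom (content t)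

theorem altChar_eq_coeffAt (N : ℕ) (ν : n.Partition) (g : Perm (Fin n)) :
    altChar N ν g = coeffAt (shifted ν) (alternant (fun j => (Fin.rev j : ℕ)) * cyclePoly N g) := by
  rw [alternant_eq_sum, sum_mul, map_sum, altChar]
  refine sum_congr rfl fun π _ => ?_
  rw [cyclePoly, smul_mul_assoc, map_smul, smul_eq_mul, mul_sum, map_sum]
  congr 1
  simp_rw [monom_mul_monom, coeffAt_monom]
  rw [← sum_filter, filter_filter, sum_const, nsmul_eq_mul, mul_one]
  congr 2
  ext t
  rw [mem_filter, mem_filter]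
  simp only [mem_univ, true_and, funext_iff, Function.comp_apply, Pi.add_apply, content, add_comm]

theorem coeff_completeSeries (N b : ℕ) :
    PowerSeries.coeff b (completeSeries N) = ∑ f ∈ (univ : Finset (Fin N)).piAntidiag b, monom f := by
  rw [completeSeries, PowerSeries.coeff_prod]
  refine sum_bij' (fun f _ => f) (fun f _ => Finsupp.equivFunOnFinite.symm f) ?_ ?_ (by simp)
    (by simp) ?_
  · intro f hf
    simpa using hf
  · intro f hf
    simpa using hf
  · intro f _
    simp [monom_eq_prod]

/-- Averaging the cycle polynomials against a permutation character yields a product of complete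
homogeneous polynomials. -/
theorem sum_card_fixed_smul_cyclePoly {N : ℕ} (r ℓ : Fin N → ℕ)
    (hℓ : ∑ j, ℓ j = n + ∑ j, r j) :
    ∑ g : Perm (Fin n), #{t : Fin n → Fin N | (∀ k, t (g k) = t k) ∧
        ∀ i, #{k | t k = i} + r i = ℓ i} • cyclePoly N g =
      n.factorial • ∏ j, PowerSeries.coeff (ℓ j) (PowerSeries.X ^ r j * completeSeries N) := by
  -- If some `r j` exceeds `ℓ j`, no filling qualifies, and the matching coefficient of the shifted
  -- series is zero.
  by_cases hr : ∀ j, r j ≤ ℓ j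
  swap
  · obtain ⟨j, hj⟩ := not_forall.1 hr
    rw [prod_eq_zero (mem_univ j), smul_zero]
    · refine sum_eq_zero fun g _ => ?_
      rw [filter_eq_empty_iff.2, card_empty, zero_smul]
      rintro t - ⟨-, h⟩
      have := h j
      omega
    · rw [PowerSeries.coeff_X_pow_mul', if_neg hj]
  set β : Fin N → ℕ := fun j => ℓ j - r j with hβ
  have hℓβ : ∀ j, ℓ j = β j + r j := fun j => by have := hr j; simp only [hβ]; omega
  have hβn : ∑ j, β j = n := by
    have h : ∑ j, ℓ j = ∑ j, β j + ∑ j, r j := by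
      rw [← sum_add_distrib]
      exact sum_congr rfl fun j _ => hℓβ j
    omega
  -- A pair of fillings fixed by `g` is one fixed filling by pairs. Its content is a matrix: the
  -- first marginal is prescribed to be `β`, the second gives the monomial.
  set W : (Fin N × Fin N → ℕ) → MvPolynomial (Fin N) ℤ := fun A =>
    if ∀ j, ∑ i, A (j, i) = β j then monom fun i => ∑ j, A (j, i) else 0 with hW
  have hfst : ∀ (s : Fin n → Fin N × Fin N) (j : Fin N),
      ∑ i, content s (j, i) = content (fun k => (s k).1) j := by
    intro s j
    rw [content, card_eq_sum_card_fiberwise (f := fun k => (s k).2) (t := univ) (by simp)]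
    simp only [content, filter_filter, Prod.ext_iff]
  have hsnd : ∀ (s : Fin n → Fin N × Fin N) (i : Fin N),
      ∑ j, content s (j, i) = content (fun k => (s k).2) i := by
    intro s j
    rw [content, card_eq_sum_card_fiberwise (f := fun k => (s k).1) (t := univ) (by simp)]
    simp only [content, filter_filter, Prod.ext_iff, and_comm]
  have hL : ∀ g : Perm (Fin n), #{t : Fin n → Fin N | (∀ k, t (g k) = t k) ∧
        ∀ i, #{k | t k = i} + r i = ℓ i} • cyclePoly N g =
      ∑ s : Fin n → Fin N × Fin N with s ∘ g = s, W (content s) := by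
    intro g
    have hW' : ∀ s : Fin n → Fin N × Fin N, W (content s) = if ∀ j, content (fun k => (s k).1) j = β j then
        monom (content fun k => (s k).2) else 0 := by
      intro s
      simp only [hW, hfst, hsnd]
    simp_rw [hW']
    rw [cyclePoly, ← sum_const, ← sum_product', ← sum_filter, filter_filter]
    refine sum_bij' (fun p _ k => (p.1 k, p.2 k)) (fun s _ => (fun k => (s k).1, fun k => (s k).2))
      ?_ ?_ (by simp) (by simp) (by simp)
    · intro p hp
      simp only [mem_product, mem_filter, mem_univ, true_and, funext_iff, Function.comp_apply,
        hℓβ, add_left_inj] at hp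
      simp only [mem_filter, mem_univ, true_and, funext_iff, Function.comp_apply, Prod.ext_iff]
      exact ⟨fun k => ⟨hp.1.1 k, hp.2 k⟩, hp.1.2⟩
    · intro s hs
      simp only [mem_filter, mem_univ, true_and, funext_iff, Function.comp_apply,
        Prod.ext_iff] at hs
      simp only [mem_product, mem_filter, mem_univ, true_and, funext_iff, Function.comp_apply,
        hℓβ, add_left_inj]
      exact ⟨⟨fun k => (hs.1 k).1, hs.2⟩, fun k => (hs.1 k).2⟩
  rw [sum_congr rfl fun g _ => hL g, sum_fixed_fillings]
  congr 1
  have hR : ∀ j, PowerSeries.coeff (ℓ j) (PowerSeries.X ^ r j * completeSeries N) =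
      ∑ f ∈ (univ : Finset (Fin N)).piAntidiag (β j), monom f := fun j => by
    rw [PowerSeries.coeff_X_pow_mul', if_pos (hr j), coeff_completeSeries]
  rw [prod_congr rfl fun j _ => hR j, prod_univ_sum]
  simp only [hW]
  rw [← sum_filter]
  refine sum_bij' (fun A _ j i => A (j, i)) (fun F _ p => F p.1 p.2) ?_ ?_ (by simp) (by simp) ?_
  · intro A hA
    simpa [Fintype.mem_piFinset] using (mem_filter.1 hA).2
  · intro F hF
    have hF' : ∀ j, ∑ i, F j i = β j := by simpa [Fintype.mem_piFinset] using hF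
    simp [hF', Fintype.sum_prod_type, hβn]
  · intro A _
    simp only [monom_eq_prod]
    rw [prod_comm]
    exact prod_congr rfl fun i _ => (prod_pow_eq_pow_sum _ _ _).symm

/-! ### The norm of the alternating sum and its identification with the Specht character -/

theorem shifted_strictAnti (ν : n.Partition) {N : ℕ} : StrictAnti (shifted ν (N := N)) := by
  intro i j hij
  have h1 := (diagram ν).rowLen_anti i j hij.le
  have h2 : Fin.rev j < Fin.rev i := Fin.rev_lt_rev.2 hij
  rw [Fin.lt_def] at h2
  simp only [shifted]
  omega

theorem sum_rowLen (ν : n.Partition) {N : ℕ} (hN : n ≤ N) :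
    ∑ i : Fin N, (diagram ν).rowLen i = n := by
  simp_rw [← card_rowFill ν hN]
  exact (sum_content _).trans (Fintype.card_fin n)

theorem coeffAt_alternant {N : ℕ} {e : Fin N → ℕ} (he : StrictAnti e) :
    coeffAt e (alternant e) = 1 := by
  rw [alternant_eq_sum, map_sum, sum_eq_single 1]
  · simp [coeffAt_monom]
  · intro π _ hπ
    rw [map_smul, coeffAt_monom, if_neg, smul_zero]
    intro h
    refine hπ (Equiv.ext fun i => he.injective (congrFun h i))
  · simp

/-- Averaging `altChar` against the cycle polynomials gives `n!` times the Jacobi-Trudi determinant;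
multiplying by the staircase alternant makes it `n!` times the alternant of `ν + δ`. The coefficient
at `ν + δ` is `n!` on this side, and recovers a second factor `altChar` on the other. -/
theorem sum_altChar_sq (ν : n.Partition) {N : ℕ} (hN : n ≤ N) :
    ∑ g, altChar N ν g * altChar N ν g = n.factorial := by
  have h1 : ∑ g, altChar N ν g • cyclePoly N g =
      n.factorial • (jacobiTrudi (shifted ν (N := N))).det := by
    simp_rw [altChar, sum_smul]
    rw [sum_comm, Matrix.det_apply, smul_sum]
    refine sum_congr rfl fun π _ => ?_
    have h2 := sum_card_fixed_smul_cyclePoly (n := n) (fun i => (Fin.rev (π i) : ℕ)) (shifted ν) (by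
      simp only [shifted]
      rw [sum_add_distrib, sum_rowLen ν hN, Equiv.sum_comp π fun i => (Fin.rev i : ℕ)])
    simp_rw [mul_smul]
    rw [← smul_sum, smul_comm, Units.smul_def]
    congr 1
  have h3 : ∀ g, altChar N ν g * altChar N ν g = coeffAt (shifted ν)
      (alternant (fun j => (Fin.rev j : ℕ)) * (altChar N ν g • cyclePoly N g)) := by
    intro g
    rw [mul_smul_comm, map_smul, ← altChar_eq_coeffAt, smul_eq_mul]
  simp_rw [h3]
  rw [← map_sum, ← mul_sum, h1, mul_smul_comm, ← alternant_eq_mul_det_jacobiTrudi, map_nsmul,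
    coeffAt_alternant (shifted_strictAnti ν)]
  simp

/-- The Specht character is the alternating sum of permutation characters. -/
theorem spechtChar_eq_altChar (ν : n.Partition) {N : ℕ} (hN : n ≤ N) (g : Perm (Fin n)) :
    spechtChar ν g = altChar N ν g := by
  -- The expansion is `n! - 2 n! + n!`. Both functions are real, so the summands are absolute
  -- squares.
  have h1 : ∑ g, (spechtChar ν g - altChar N ν g) * (spechtChar ν g - altChar N ν g) = 0 := by
    have h2 := congrArg (Int.cast (R := ℂ)) (sum_altChar_sq ν hN)
    push_cast at h2
    have h3 := sum_spechtChar_altChar ν hN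
    have h4 := sum_spechtChar_sq ν
    have h5 : ∀ g, (spechtChar ν g - altChar N ν g) * (spechtChar ν g - altChar N ν g) =
        spechtChar ν g * spechtChar ν g - 2 * (spechtChar ν g * altChar N ν g) +
          altChar N ν g * altChar N ν g := fun g => by ring
    simp_rw [h5, sum_add_distrib, sum_sub_distrib, ← mul_sum, h2, h3, h4]
    ring
  have h6 : ∀ g, (spechtChar ν g - altChar N ν g) * (spechtChar ν g - altChar N ν g) =
      ((Complex.normSq (spechtChar ν g - altChar N ν g) : ℝ) : ℂ) := by
    intro g
    have hs : (starRingEnd ℂ) (spechtChar ν g - altChar N ν g) = spechtChar ν g - altChar N ν g := by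
      have := star_spechtChar ν g
      rw [← starRingEnd_apply] at this
      rw [map_sub, this, map_intCast]
    rw [← Complex.mul_conj, hs]
  simp_rw [h6] at h1
  rw [← Complex.ofReal_sum, Complex.ofReal_eq_zero,
    sum_eq_zero_iff_of_nonneg fun g _ => Complex.normSq_nonneg _] at h1
  exact sub_eq_zero.1 (Complex.normSq_eq_zero.1 (h1 g (mem_univ _)))

end

end MarinoVafa

namespace MarinoVafa

noncomputable section

open Finset Equiv

variable {n : ℕ}

/-! ### Strictly decreasing sequences and partitions -/

theorem diagram_rowLens (ν : n.Partition) : (diagram ν).rowLens = ν.parts.sort (· ≥ ·) :=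
  YoungDiagram.rowLens_ofRowLens_eq_self fun _ hx => ν.parts_pos ((Multiset.mem_sort _).1 hx)

theorem diagram_injective : Function.Injective (diagram (n := n)) := by
  intro ν ν' h
  have h1 := congrArg YoungDiagram.rowLens h
  rw [diagram_rowLens, diagram_rowLens] at h1
  refine Nat.Partition.ext ?_
  rw [← Multiset.sort_eq ν.parts (· ≥ ·), h1, Multiset.sort_eq]

theorem exists_diagram_eq (μ : YoungDiagram) (hμ : μ.cells.card = n) :
    ∃ ν : n.Partition, diagram ν = μ := by
  have hsum : μ.rowLens.sum = n := by
    rw [← card_cellsOfRowLens, ← hμ]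
    exact congrArg (fun μ : YoungDiagram => μ.cells.card) μ.ofRowLens_to_rowLens_eq_self
  refine ⟨⟨(μ.rowLens : Multiset ℕ), fun {i} hi => μ.pos_of_mem_rowLens i (by simpa using hi),
    by simpa using hsum⟩, ?_⟩
  have hsort : (μ.rowLens : Multiset ℕ).sort (· ≥ ·) = μ.rowLens := by
    refine List.Perm.eq_of_pairwise' (r := (· ≥ ·)) ?_ ?_ ?_
    · exact Multiset.pairwise_sort _ _
    · exact μ.rowLens_sorted.pairwise
    · exact Multiset.coe_eq_coe.1 (Multiset.sort_eq _ _)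
  conv_rhs => rw [← μ.ofRowLens_to_rowLens_eq_self]
  simp only [diagram, hsort]

theorem rowLen_eq_zero (ν : n.Partition) {i : ℕ} (hi : n ≤ i) : (diagram ν).rowLen i = 0 := by
  by_contra h
  obtain ⟨k, h1, -⟩ := exists_rowIdx_colIdx ν (i := i) (j := 0)
    (YoungDiagram.mem_iff_lt_rowLen.2 (Nat.pos_of_ne_zero h))
  have := rowIdx_lt ν k
  omega

theorem shifted_injective {N : ℕ} (hN : n ≤ N) {ν ν' : n.Partition}
    (h : shifted ν (N := N) = shifted ν') : ν = ν' := by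
  refine diagram_injective (YoungDiagram.ext ?_)
  ext ⟨i, j⟩
  rw [YoungDiagram.mem_cells, YoungDiagram.mem_cells, YoungDiagram.mem_iff_lt_rowLen,
    YoungDiagram.mem_iff_lt_rowLen]
  rcases lt_or_ge i N with hi | hi
  · have h1 := congrFun h ⟨i, hi⟩
    simp only [shifted, add_left_inj] at h1
    rw [h1]
  · rw [rowLen_eq_zero ν (hN.trans hi), rowLen_eq_zero ν' (hN.trans hi)]

theorem add_sub_le_of_strictAnti {N : ℕ} {e : Fin N → ℕ} (he : StrictAnti e) {i j : Fin N}
    (hij : i ≤ j) : e j + (j - i : ℕ) ≤ e i := by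
  have h1 : #(Ioc i j) ≤ #(Ico (e j) (e i)) :=
    card_le_card_of_injOn e (fun k hk => by
      rw [coe_Ioc, Set.mem_Ioc] at hk
      exact mem_coe.2 (mem_Ico.2 ⟨he.antitone hk.2, he hk.1⟩)) he.injective.injOn
  rw [Fin.card_Ioc, Nat.card_Ico] at h1
  have := he.antitone hij
  omega

theorem rev_le_of_strictAnti {N : ℕ} {e : Fin N → ℕ} (he : StrictAnti e) (i : Fin N) :
    (Fin.rev i : ℕ) ≤ e i := by
  have h1 := add_sub_le_of_strictAnti he (i := i) (j := ⟨N - 1, by have := i.pos; omega⟩)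
    (Fin.le_def.2 (by have := i.2; simp only; omega))
  rw [Fin.val_rev]
  simp only at h1
  omega

/-- Removing the staircase leaves a weakly decreasing sequence. With `shifted_injective`, partitions
of `n` correspond to strictly decreasing exponents of the right total degree. -/
theorem exists_shifted_eq {N : ℕ} {e : Fin N → ℕ} (he : StrictAnti e)
    (hsum : ∑ i, e i = n + ∑ i : Fin N, (Fin.rev i : ℕ)) :
    ∃ ν : n.Partition, shifted ν = e := by
  have hrev := rev_le_of_strictAnti he
  have hanti : Antitone fun i => e i - (Fin.rev i : ℕ) := by
    intro i j hij
    have h1 := add_sub_le_of_strictAnti he hij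
    have h2 := Fin.le_def.1 hij
    have h3 := hrev j
    have h4 := j.2
    simp only [Fin.val_rev] at h3 ⊢
    omega
  have hw : (List.ofFn fun i => e i - (Fin.rev i : ℕ)).SortedGE :=
    hanti.sortedGE_ofFn
  obtain ⟨ν, hν⟩ := exists_diagram_eq (n := n) (YoungDiagram.ofRowLens _ hw) (by
    refine (card_cellsOfRowLens _).trans ?_
    rw [List.sum_ofFn]
    have h1 : ∑ i, e i = ∑ i, (e i - (Fin.rev i : ℕ)) + ∑ i : Fin N, (Fin.rev i : ℕ) := by
      rw [← sum_add_distrib]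
      exact sum_congr rfl fun i _ => (Nat.sub_add_cancel (hrev i)).symm
    omega)
  refine ⟨ν, funext fun i => ?_⟩
  have h1 := YoungDiagram.rowLen_ofRowLens (hw := hw) ⟨i, by simp⟩
  have h2 : (diagram ν).rowLen i = e i - (Fin.rev i : ℕ) := by
    rw [hν]
    exact h1.trans (by simp)
  rw [shifted, h2, Nat.sub_add_cancel (hrev i)]

/-- A strictly decreasing sequence is determined by its range. Hence alternants of different
partitions share no monomial. -/
theorem eq_of_comp_perm_eq {N : ℕ} {e f : Fin N → ℕ} (he : StrictAnti e) (hf : StrictAnti f)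
    {σ τ : Perm (Fin N)} (h : e ∘ σ = f ∘ τ) : e = f ∧ σ = τ := by
  have h1 : e = f := by
    have h2 : e ∘ Fin.rev = f ∘ Fin.rev := by
      refine (StrictMono.range_inj (he.comp Fin.rev_strictAnti) (hf.comp Fin.rev_strictAnti)).1 ?_
      rw [Fin.rev_surjective.range_comp, Fin.rev_surjective.range_comp,
        ← σ.surjective.range_comp e, h, τ.surjective.range_comp]
    funext i
    simpa using congrFun h2 (Fin.rev i)
  subst h1
  exact ⟨rfl, Equiv.ext fun i => he.injective (congrFun h i)⟩

theorem exists_strictAnti_comp_perm {N : ℕ} {e : Fin N → ℕ} (he : Function.Injective e) :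
    ∃ (f : Fin N → ℕ) (σ : Perm (Fin N)), StrictAnti f ∧ e = f ∘ σ := by
  refine ⟨e ∘ Tuple.sort e ∘ Fin.rev, (Fin.revPerm.trans (Tuple.sort e)).symm, ?_, ?_⟩
  · have h1 : StrictMono (e ∘ Tuple.sort e) :=
      (Tuple.monotone_sort e).strictMono_of_injective (he.comp (Tuple.sort e).injective)
    exact h1.comp_strictAnti Fin.rev_strictAnti
  · funext i
    simp

/-! ### The expansion into alternants -/

theorem rename_monom {N : ℕ} (σ : Perm (Fin N)) (e : Fin N → ℕ) :
    MvPolynomial.rename σ (monom e) = monom (e ∘ σ.symm) := by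
  rw [monom_eq_prod, monom_eq_prod, map_prod]
  conv_rhs => rw [← Equiv.prod_comp σ]
  simp

theorem coeffAt_rename {N : ℕ} (σ : Perm (Fin N)) (e : Fin N → ℕ) (p : MvPolynomial (Fin N) ℤ) :
    coeffAt e (MvPolynomial.rename σ p) = coeffAt (e ∘ σ) p := by
  simp only [coeffAt, MvPolynomial.lcoeff_apply]
  rw [← MvPolynomial.coeff_rename_mapDomain σ σ.injective p]
  congr 1
  ext i
  rw [Finsupp.mapDomain_equiv_apply]
  simp

theorem rename_alternant {N : ℕ} (σ : Perm (Fin N)) (e : Fin N → ℕ) :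
    MvPolynomial.rename σ (alternant e) = (Perm.sign σ : ℤ) • alternant e := by
  rw [alternant, AlgHom.map_det, zsmul_eq_mul, ← Matrix.det_permute]
  congr 1
  ext1 i j
  simp

theorem rename_cyclePoly {N : ℕ} (σ : Perm (Fin N)) (g : Perm (Fin n)) :
    MvPolynomial.rename σ (cyclePoly N g) = cyclePoly N g := by
  rw [cyclePoly, map_sum]
  refine sum_bij' (fun t _ => σ ∘ t) (fun t _ => σ.symm ∘ t) ?_ ?_ ?_ ?_ ?_
  · intro t ht
    simp only [mem_filter, mem_univ, true_and] at ht ⊢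
    rw [Function.comp_assoc, ht]
  · intro t ht
    simp only [mem_filter, mem_univ, true_and] at ht ⊢
    rw [Function.comp_assoc, ht]
  · intro t _
    funext k
    simp
  · intro t _
    funext k
    simp
  · intro t _
    rw [rename_monom]
    congr 1
    funext i
    simp [content, eq_symm_apply]

theorem coeffAt_alternant_mul_cyclePoly_eq_zero {N : ℕ} {e : Fin N → ℕ} (g : Perm (Fin n))
    (h : ∑ i, e i ≠ n + ∑ i : Fin N, (Fin.rev i : ℕ)) :
    coeffAt e (alternant (fun j => (Fin.rev j : ℕ)) * cyclePoly N g) = 0 := by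
  rw [alternant_eq_sum, sum_mul, map_sum]
  refine sum_eq_zero fun π _ => ?_
  rw [cyclePoly, smul_mul_assoc, map_smul, smul_eq_mul, mul_sum, map_sum,
    sum_eq_zero, mul_zero]
  intro t _
  rw [monom_mul_monom, coeffAt_monom, if_neg]
  rintro rfl
  apply h
  simp only [Pi.add_apply, Function.comp_apply, sum_add_distrib, sum_content, Fintype.card_fin]
  rw [Equiv.sum_comp π fun i => (Fin.rev i : ℕ), add_comm]

/-- Frobenius' formula. -/
theorem alternant_mul_cyclePoly {N : ℕ} (hN : n ≤ N) (g : Perm (Fin n)) :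
    alternant (fun j => (Fin.rev j : ℕ)) * cyclePoly N g =
      ∑ ν : n.Partition, altChar N ν g • alternant (shifted ν (N := N)) := by
  set F := alternant (fun j : Fin N => (Fin.rev j : ℕ)) * cyclePoly N g with hF
  have hanti : ∀ (σ : Perm (Fin N)) e, coeffAt (e ∘ σ) F = (Perm.sign σ : ℤ) * coeffAt e F := by
    intro σ e
    rw [← coeffAt_rename, hF, map_mul, rename_alternant, rename_cyclePoly, smul_mul_assoc,
      map_smul, smul_eq_mul]
  suffices h : ∀ e : Fin N → ℕ, coeffAt e F =
      coeffAt e (∑ ν : n.Partition, altChar N ν g • alternant (shifted ν (N := N))) by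
    ext m
    have h1 := h m
    simp only [coeffAt, MvPolynomial.lcoeff_apply, Finsupp.equivFunOnFinite_symm_coe] at h1
    exact h1
  intro e
  have hR : coeffAt e (∑ ν : n.Partition, altChar N ν g • alternant (shifted ν (N := N))) =
      ∑ ν : n.Partition, altChar N ν g * ∑ π : Perm (Fin N), (Perm.sign π : ℤ) *
        if shifted ν ∘ π = e then 1 else 0 := by
    simp only [map_sum, map_smul, smul_eq_mul, alternant_eq_sum, coeffAt_monom]
  rw [hR]
  -- Antisymmetry kills exponents with a repetition and homogeneity kills those of the wrong degree.
  -- Any other `e` is a rearrangement of a unique `shifted ν`, where the coefficient is `altChar` up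
  -- to the sign of the rearrangement.
  by_cases he : Function.Injective e
  swap
  · have h0 : coeffAt e F = 0 := by
      simp only [Function.Injective, not_forall] at he
      obtain ⟨p, q, h1, h2⟩ := he
      have h3 : e ∘ swap p q = e := by
        funext k
        rw [Function.comp_apply, swap_apply_def]
        split_ifs with ha hb
        · rw [ha, h1]
        · rw [hb, h1]
        · rfl
      have h4 := hanti (swap p q) e
      rw [h3, Perm.sign_swap h2] at h4
      simp only [Units.val_neg, Units.val_one, neg_mul, one_mul] at h4
      omega
    rw [h0, sum_eq_zero]
    intro ν _
    rw [sum_eq_zero, mul_zero]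
    intro π _
    rw [if_neg, mul_zero]
    rintro rfl
    exact he ((shifted_strictAnti ν).injective.comp π.injective)
  by_cases hs : ∑ i, e i = n + ∑ i : Fin N, (Fin.rev i : ℕ)
  swap
  · rw [hF, coeffAt_alternant_mul_cyclePoly_eq_zero g hs, sum_eq_zero]
    intro ν _
    rw [sum_eq_zero, mul_zero]
    intro π _
    rw [if_neg, mul_zero]
    rintro rfl
    apply hs
    simp only [Function.comp_apply]
    rw [Equiv.sum_comp π (shifted ν)]
    simp only [shifted]
    rw [sum_add_distrib, sum_rowLen ν hN]
  obtain ⟨f, σ, hf, rfl⟩ := exists_strictAnti_comp_perm he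
  simp only [Function.comp_apply] at hs
  rw [Equiv.sum_comp σ f] at hs
  obtain ⟨ν, rfl⟩ := exists_shifted_eq hf hs
  rw [sum_eq_single ν, sum_eq_single σ]
  · rw [if_pos rfl, hanti, hF, ← altChar_eq_coeffAt]
    ring
  · intro π _ hπ
    rw [if_neg, mul_zero]
    exact fun h => hπ (eq_of_comp_perm_eq hf hf h).2
  · simp
  · intro ν' _ hν
    rw [sum_eq_zero, mul_zero]
    intro π _
    rw [if_neg, mul_zero]
    exact fun h => hν (shifted_injective hN (eq_of_comp_perm_eq (shifted_strictAnti ν') hf h).1)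
  · simp

end

end MarinoVafa

namespace MarinoVafa

noncomputable section

open Finset Equiv

/-! ### Power sums -/

section Orbits

/-- The cycles of a permutation, fixed points included. -/
abbrev Cycles {α : Type*} (g : Perm α) : Type _ := Quotient (Perm.SameCycle.setoid g)

theorem mk_eq_mk_iff {α : Type*} {g : Perm α} {a b : α} :
    (⟦a⟧ : Cycles g) = ⟦b⟧ ↔ Perm.SameCycle g a b := Quotient.eq

variable {α : Type*} [Fintype α] [DecidableEq α]

instance (g : Perm α) : DecidableRel (Perm.SameCycle.setoid g).r :=
  fun a b => inferInstanceAs (Decidable (Perm.SameCycle g a b))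

instance (g : Perm α) : Fintype (Cycles g) := Quotient.fintype _

instance (g : Perm α) : DecidableEq (Cycles g) := Quotient.decidableEq

/-- The number of elements of a cycle. -/
def cycleCard (g : Perm α) (c : Cycles g) : ℕ := #{k : α | (⟦k⟧ : Cycles g) = c}

theorem cycleCard_mk {g : Perm α} {a : α} (ha : a ∈ g.support) :
    cycleCard g ⟦a⟧ = #(g.cycleOf a).support := by
  rw [cycleCard]
  congr 1
  ext b
  rw [mem_filter, mk_eq_mk_iff, Perm.mem_support_cycleOf_iff]
  simp [ha, Perm.sameCycle_comm]

theorem cycleCard_mk_of_notMem {g : Perm α} {a : α} (ha : a ∉ g.support) :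
    cycleCard g ⟦a⟧ = 1 := by
  rw [cycleCard, card_eq_one]
  refine ⟨a, ?_⟩
  ext b
  rw [mem_filter, mk_eq_mk_iff, mem_singleton]
  have h1 : Function.IsFixedPt g a := Perm.notMem_support.1 ha
  refine ⟨fun h => (h.2.symm.eq_of_left h1).symm, ?_⟩
  rintro rfl
  exact ⟨mem_univ _, Perm.SameCycle.refl _ _⟩

/-- The cycle of a permutation as an element of the quotient, mapped to the cyclic permutation. -/
def toCycle (g : Perm α) (c : Cycles g) : Perm α :=
  Quotient.lift (fun a => g.cycleOf a) (fun _ _ h => Perm.SameCycle.cycleOf_eq h) c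

/-- `cycleType` omits fixed points, so the orbits are split by whether their cyclic permutation is
trivial, matching the two summands of `partition`. -/
theorem prod_cycles {M : Type*} [CommMonoid M] (g : Perm α) (f : ℕ → M) :
    ∏ c : Cycles g, f (cycleCard g c) = (g.partition.parts.map f).prod := by
  rw [Perm.parts_partition, Multiset.map_add, Multiset.prod_add, Multiset.map_replicate,
    Multiset.prod_replicate, Perm.cycleType_def, Multiset.map_map,
    ← prod_filter_mul_prod_filter_not univ (fun c : Cycles g => toCycle g c ≠ 1)]
  congr 1
  · change _ = ∏ c ∈ g.cycleFactorsFinset, f #c.support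
    refine prod_bij (fun c _ => toCycle g c) ?_ ?_ ?_ ?_
    · intro c
      induction c using Quotient.inductionOn with
      | h a =>
        intro hc
        have h1 : g.cycleOf a ≠ 1 := (mem_filter.1 hc).2
        exact Perm.cycleOf_mem_cycleFactorsFinset_iff.2
          (Perm.mem_support.2 fun h => h1 ((Perm.cycleOf_eq_one_iff g).2 h))
    · intro c hc d hd
      induction c using Quotient.inductionOn with
      | h a =>
        induction d using Quotient.inductionOn with
        | h b =>
          intro h
          have h1 : g.cycleOf a ≠ 1 := (mem_filter.1 hc).2
          have h2 : g.cycleOf a = g.cycleOf b := h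
          have ha : a ∈ (g.cycleOf a).support := Perm.mem_support_cycleOf_iff.2
            ⟨Perm.SameCycle.refl _ _, Perm.mem_support.2 fun h => h1 ((Perm.cycleOf_eq_one_iff g).2 h)⟩
          rw [h2] at ha
          exact mk_eq_mk_iff.2 (Perm.mem_support_cycleOf_iff.1 ha).1.symm
    · intro σ hσ
      obtain ⟨a, ha⟩ : ∃ a, a ∈ σ.support := by
        have := (Perm.mem_cycleFactorsFinset_iff.1 hσ).1.ne_one
        rw [Ne, ← Perm.support_eq_empty_iff] at this
        exact nonempty_iff_ne_empty.2 this
      have h1 := Perm.cycle_is_cycleOf ha hσ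
      refine ⟨⟦a⟧, mem_filter.2 ⟨mem_univ _, ?_⟩, h1.symm⟩
      change g.cycleOf a ≠ 1
      rw [← h1]
      exact (Perm.mem_cycleFactorsFinset_iff.1 hσ).1.ne_one
    · intro c
      induction c using Quotient.inductionOn with
      | h a =>
        intro hc
        have h1 : g.cycleOf a ≠ 1 := (mem_filter.1 hc).2
        have ha : a ∈ g.support :=
          Perm.mem_support.2 fun h => h1 ((Perm.cycleOf_eq_one_iff g).2 h)
        rw [cycleCard_mk ha]
        rfl
  · have hfix : ∀ a, a ∉ g.support ↔ g.cycleOf a = 1 := fun a => by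
      rw [Perm.cycleOf_eq_one_iff, Perm.notMem_support]
    rw [← card_compl, ← prod_const]
    symm
    refine prod_bij (fun a _ => ⟦a⟧) ?_ ?_ ?_ ?_
    · intro a ha
      refine mem_filter.2 ⟨mem_univ _, not_not.2 ?_⟩
      exact (hfix a).1 (mem_compl.1 ha)
    · intro a ha b _ h
      have h1 : Function.IsFixedPt g a := Perm.notMem_support.1 (mem_compl.1 ha)
      exact (mk_eq_mk_iff.1 h).eq_of_left h1
    · intro c
      induction c using Quotient.inductionOn with
      | h a =>
        intro hc
        refine ⟨a, mem_compl.2 ((hfix a).2 ?_), rfl⟩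
        exact not_not.1 (mem_filter.1 hc).2
    · intro a ha
      rw [cycleCard_mk_of_notMem (mem_compl.1 ha)]

/-- A filling fixed by `g` is a free choice of value on each cycle; a cycle of length `d`
contributes the `d`-th power sum. -/
theorem sum_fixed_prod {K : Type*} [CommSemiring K] {ι : Type*} [Fintype ι] [DecidableEq ι]
    (g : Perm α) (x : ι → K) :
    ∑ t : α → ι with t ∘ g = t, ∏ k, x (t k) =
      (g.partition.parts.map fun d => ∑ i, x i ^ d).prod := by
  rw [← prod_cycles g fun d => ∑ i, x i ^ d, prod_univ_sum]
  symm
  refine sum_bij (fun u _ a => u ⟦a⟧) ?_ ?_ ?_ ?_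
  · intro u _
    refine mem_filter.2 ⟨mem_univ _, funext fun a => ?_⟩
    have h1 : (⟦g a⟧ : Cycles g) = ⟦a⟧ :=
      mk_eq_mk_iff.2 (Perm.sameCycle_apply_left.2 (Perm.SameCycle.refl _ _))
    simp only [Function.comp_apply, h1]
  · intro u _ v _ h
    funext c
    induction c using Quotient.inductionOn with
    | h a => exact congrFun h a
  · intro t ht
    have h1 : ∀ a, t (g a) = t a := congrFun (mem_filter.1 ht).2
    have h2 : ∀ (m : ℕ) a, t ((g ^ m) a) = t a := by
      intro m
      induction m with
      | zero => simp
      | succ m ih =>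
        intro a
        rw [pow_succ, Perm.mul_apply, ih, h1]
    refine ⟨fun c => Quotient.lift t (fun a b hab => ?_) c, by simp, rfl⟩
    obtain ⟨m, -, -, hm⟩ := Perm.SameCycle.exists_pow_eq g hab
    rw [← hm, h2]
  · intro u _
    rw [← prod_fiberwise_of_maps_to (g := fun a => (⟦a⟧ : Cycles g)) (t := univ) (by simp)]
    refine prod_congr rfl fun c _ => ?_
    rw [cycleCard, ← prod_const]
    exact prod_congr rfl fun a ha => by dsimp only; rw [(mem_filter.1 ha).2]

end Orbits

/-! ### Frobenius' formula at a geometric progression -/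

theorem aeval_cyclePoly {n N : ℕ} {K : Type*} [CommRing K] (x : Fin N → K) (g : Perm (Fin n)) :
    MvPolynomial.aeval x (cyclePoly N g) =
      (g.partition.parts.map fun d => ∑ i, x i ^ d).prod := by
  rw [← sum_fixed_prod, cyclePoly, map_sum]
  refine sum_congr rfl fun t _ => ?_
  rw [← prod_X_eq_monom_content, map_prod]
  simp

/-- The entries `(q^i)^{e_j} = (q^{e_j})^i` form a transposed Vandermonde matrix in the nodes
`q^{e_j}`. -/
theorem aeval_alternant {N : ℕ} {K : Type*} [CommRing K] (q : K) (e : Fin N → ℕ) :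
    MvPolynomial.aeval (fun i : Fin N => q ^ (i : ℕ)) (alternant e) =
      ∏ i, ∏ j ∈ Ioi i, (q ^ e j - q ^ e i) := by
  rw [← Matrix.det_vandermonde, ← Matrix.det_transpose, alternant, AlgHom.map_det]
  congr 1
  ext1 i j
  simp [Matrix.vandermonde, ← pow_mul, mul_comm]

/-- Frobenius' formula at a geometric progression. -/
theorem prod_powerSum_geometric {n N : ℕ} (hN : n ≤ N) {K : Type*} [Field K] [Algebra ℂ K] (q : K)
    (g : Perm (Fin n)) :
    (∏ i : Fin N, ∏ j ∈ Ioi i, (q ^ (Fin.rev j : ℕ) - q ^ (Fin.rev i : ℕ))) *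
        (g.partition.parts.map fun d => ∑ i : Fin N, (q ^ (i : ℕ)) ^ d).prod =
      ∑ ν : n.Partition, algebraMap ℂ K (spechtChar ν g) *
        ∏ i : Fin N, ∏ j ∈ Ioi i, (q ^ shifted ν j - q ^ shifted ν i) := by
  have h := congrArg (MvPolynomial.aeval fun i : Fin N => q ^ (i : ℕ))
    (alternant_mul_cyclePoly hN g)
  rw [map_mul, aeval_alternant, aeval_cyclePoly, map_sum] at h
  rw [h]
  refine sum_congr rfl fun ν _ => ?_
  rw [map_zsmul, aeval_alternant, spechtChar_eq_altChar ν hN, zsmul_eq_mul, map_intCast]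

end

end MarinoVafa

namespace MarinoVafa

noncomputable section

open Finset Equiv

/-! ### Hook lengths -/

section Young

variable (μ : YoungDiagram)

/-- The hook length of a cell. -/
def hookLen (i j : ℕ) : ℕ := μ.rowLen i + μ.colLen j - i - j - 1

theorem lt_rowLen_iff {i j : ℕ} : j < μ.rowLen i ↔ i < μ.colLen j := by
  rw [← YoungDiagram.mem_iff_lt_rowLen, YoungDiagram.mem_iff_lt_colLen]

theorem colLen_le {N : ℕ} (hN : ∀ i, N ≤ i → μ.rowLen i = 0) (j : ℕ) : μ.colLen j ≤ N := by
  by_contra! h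
  have h1 := (lt_rowLen_iff μ).2 h
  rw [hN N le_rfl] at h1
  omega

/-- The hook lengths in row `i` and the differences `ℓ_i - ℓ_b`, `b > i`, of the shifted row
lengths `ℓ` exhaust `1, …, ℓ_i`. -/
theorem prod_diff_mul_prod_hookLen {M : Type*} [CommMonoid M] (f : ℕ → M) {N i : ℕ}
    (hN : ∀ i, N ≤ i → μ.rowLen i = 0) (hi : i < N) :
    (∏ b ∈ Ico (i + 1) N, f (μ.rowLen i - μ.rowLen b + (b - i))) *
        ∏ j ∈ range (μ.rowLen i), f (hookLen μ i j) =
      ∏ v ∈ Icc 1 (μ.rowLen i + (N - (i + 1))), f v := by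
  have hcol := colLen_le μ hN
  have hA : Set.InjOn (fun b => μ.rowLen i - μ.rowLen b + (b - i)) (Ico (i + 1) N) := by
    have key : ∀ b b', i < b → b < b' →
        μ.rowLen i - μ.rowLen b + (b - i) < μ.rowLen i - μ.rowLen b' + (b' - i) := by
      intro b b' h1 h2
      have h3 := μ.rowLen_anti b b' h2.le
      omega
    intro b hb b' hb' h
    have hb1 := (mem_Ico.1 hb).1
    have hb1' := (mem_Ico.1 hb').1
    simp only at h
    rcases lt_trichotomy b b' with h1 | h1 | h1
    · have := key b b' hb1 h1
      omega
    · exact h1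
    · have := key b' b hb1' h1
      omega
  have hB : Set.InjOn (fun j => hookLen μ i j) (range (μ.rowLen i)) := by
    have key : ∀ j j', j < j' → j' < μ.rowLen i → hookLen μ i j' < hookLen μ i j := by
      intro j j' h1 h2
      have h3 := μ.colLen_anti j j' h1.le
      have h4 := (lt_rowLen_iff μ).1 h2
      simp only [hookLen]
      omega
    intro j hj j' hj' h
    have hj1 := mem_range.1 hj
    have hj1' := mem_range.1 hj'
    simp only at h
    rcases lt_trichotomy j j' with h1 | h1 | h1
    · have := key j j' h1 hj1'
      omega
    · exact h1
    · have := key j' j h1 hj1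
      omega
  have hdisj : Disjoint ((Ico (i + 1) N).image fun b => μ.rowLen i - μ.rowLen b + (b - i))
      ((range (μ.rowLen i)).image fun j => hookLen μ i j) := by
    rw [disjoint_left]
    intro v hv hv'
    obtain ⟨b, hb, rfl⟩ := mem_image.1 hv
    obtain ⟨j, hj, h⟩ := mem_image.1 hv'
    have hb1 := (mem_Ico.1 hb).1
    have hj1 := mem_range.1 hj
    have h1 := (lt_rowLen_iff μ).1 hj1
    have h2 := lt_rowLen_iff μ (i := b) (j := j)
    have h3 := μ.rowLen_anti i b (by omega)
    simp only [hookLen] at h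
    -- A coincidence would mean `ν_b + ν'_j = b + j + 1`. The left side is at least `b + j + 2` if
    -- the cell `(b, j)` lies in the diagram and at most `b + j` if not.
    by_cases hjb : j < μ.rowLen b
    · have := h2.1 hjb
      omega
    · have : ¬ b < μ.colLen j := fun h => hjb (h2.2 h)
      omega
  have hunion : ((Ico (i + 1) N).image fun b => μ.rowLen i - μ.rowLen b + (b - i)) ∪
      ((range (μ.rowLen i)).image fun j => hookLen μ i j) =
      Icc 1 (μ.rowLen i + (N - (i + 1))) := by
    -- Both sets lie in the interval, and their sizes `N - (i + 1)` and `ν_i` add up to its length.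
    refine eq_of_subset_of_card_le (fun v hv => ?_) ?_
    · rcases mem_union.1 hv with hv | hv
      · obtain ⟨b, hb, rfl⟩ := mem_image.1 hv
        have hb1 := mem_Ico.1 hb
        rw [mem_Icc]
        omega
      · obtain ⟨j, hj, rfl⟩ := mem_image.1 hv
        have hj1 := mem_range.1 hj
        have h1 := (lt_rowLen_iff μ).1 hj1
        have h2 := hcol j
        rw [mem_Icc]
        simp only [hookLen]
        omega
    · rw [card_union_of_disjoint hdisj, card_image_of_injOn hA, card_image_of_injOn hB,
        Nat.card_Icc, Nat.card_Ico, card_range]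
      omega
  rw [← hunion, prod_union hdisj, prod_image hA, prod_image hB]

theorem prod_cells_rows {M : Type*} [CommMonoid M] (F : ℕ × ℕ → M) {N : ℕ}
    (hN : ∀ i, N ≤ i → μ.rowLen i = 0) :
    ∏ x ∈ μ.cells, F x = ∏ i ∈ range N, ∏ j ∈ range (μ.rowLen i), F (i, j) := by
  refine prod_finset_product _ _ _ fun p => ?_
  rw [YoungDiagram.mem_cells, ← Prod.mk.eta (p := p), YoungDiagram.mem_iff_lt_rowLen, mem_range,
    mem_range]
  refine ⟨fun h => ⟨?_, h⟩, fun h => h.2⟩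
  by_contra! h1
  rw [hN _ h1] at h
  omega

theorem sum_cells_rows {M : Type*} [AddCommMonoid M] (F : ℕ × ℕ → M) {N : ℕ}
    (hN : ∀ i, N ≤ i → μ.rowLen i = 0) :
    ∑ x ∈ μ.cells, F x = ∑ i ∈ range N, ∑ j ∈ range (μ.rowLen i), F (i, j) :=
  prod_cells_rows (M := Multiplicative M) μ F hN

/-- Column by column: a column of height `c` gives `c(c - 1) + c = c²` on the left and `c` copies of
`c` on the right. -/
theorem sum_cells_fst :
    2 * ∑ x ∈ μ.cells, (x.1 : ℤ) + μ.cells.card = ∑ x ∈ μ.cells, (μ.colLen x.2 : ℤ) := by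
  have hp : ∀ F : ℕ × ℕ → ℤ, ∑ x ∈ μ.cells, F x =
      ∑ j ∈ range (μ.rowLen 0), ∑ i ∈ range (μ.colLen j), F (i, j) := by
    intro F
    refine sum_finset_product_right _ _ _ fun p => ?_
    rw [YoungDiagram.mem_cells, ← Prod.mk.eta (p := p), mem_range, mem_range,
      YoungDiagram.mem_iff_lt_rowLen, ← lt_rowLen_iff]
    exact ⟨fun h => ⟨h.trans_le (μ.rowLen_anti 0 p.1 (Nat.zero_le _)), h⟩, fun h => h.2⟩
  rw [card_eq_sum_ones, Nat.cast_sum, hp, hp, hp, mul_sum, ← sum_add_distrib]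
  refine sum_congr rfl fun j _ => ?_
  have h := Finset.sum_range_id_mul_two (μ.colLen j)
  have h' : (∑ i ∈ range (μ.colLen j), (i : ℤ)) * 2 = μ.colLen j * (μ.colLen j - 1) := by
    have h1 := congrArg (Nat.cast (R := ℤ)) h
    rcases Nat.eq_zero_or_pos (μ.colLen j) with h0 | h0
    · simp [h0]
    · push_cast [Nat.cast_sub (show 1 ≤ μ.colLen j from h0)] at h1
      exact h1
  simp only [Nat.cast_one, sum_const, card_range, nsmul_eq_mul, mul_one]
  linarith

end Young

variable {n : ℕ}

/-! ### The sum of the hook lengths and the product formula for `V` -/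

theorem rowLen_eq_zero_of_len_le (ν : n.Partition) (i : ℕ) (hi : len ν ≤ i) :
    (diagram ν).rowLen i = 0 := by
  by_contra h
  have h1 : (i, 0) ∈ diagram ν := YoungDiagram.mem_iff_lt_rowLen.2 (Nat.pos_of_ne_zero h)
  obtain ⟨h2, -⟩ := YoungDiagram.mem_ofRowLens.1 h1
  rw [Multiset.length_sort] at h2
  simp only [len] at hi
  omega

/-- The statistic `n(ν) = ∑_i (i - 1) ν_i`. -/
def rowWeight (ν : n.Partition) : ℕ := ∑ x ∈ (diagram ν).cells, x.1

/-- Arm lengths summed along rows produce the squares `ν_i²` of `kappa`; leg lengths are reduced to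
`rowWeight` by `sum_cells_fst`. -/
theorem two_mul_sum_hook (ν : n.Partition) :
    2 * ∑ x ∈ (diagram ν).cells, (hook ν x : ℤ) = kappa ν + 4 * rowWeight ν + 2 * n := by
  have h1 : ∀ x ∈ (diagram ν).cells, (hook ν x : ℤ) =
      (diagram ν).rowLen x.1 - x.2 + (diagram ν).colLen x.2 - x.1 - 1 := by
    intro x hx
    have h1 := YoungDiagram.mem_iff_lt_rowLen.1 ((YoungDiagram.mem_cells x).1 hx)
    have h2 := YoungDiagram.mem_iff_lt_colLen.1 ((YoungDiagram.mem_cells x).1 hx)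
    simp only [hook]
    omega
  have h2 := sum_cells_fst (diagram ν)
  have h3 : ∑ x ∈ (diagram ν).cells, ((2 * ((diagram ν).rowLen x.1 - x.2) - 1 : ℤ)) =
      ∑ i ∈ range (len ν), ((diagram ν).rowLen i : ℤ) ^ 2 := by
    rw [sum_cells_rows (diagram ν) _ (rowLen_eq_zero_of_len_le ν)]
    refine sum_congr rfl fun i _ => ?_
    have h4 : ∀ r m : ℕ, ∑ j ∈ range m, (2 * ((r : ℤ) - j) - 1) = 2 * r * m - m ^ 2 := by
      intro r m
      induction m with
      | zero => simp
      | succ m ih =>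
        rw [sum_range_succ, ih]
        push_cast
        ring
    refine (h4 ((diagram ν).rowLen i) _).trans ?_
    ring
  have h5 : kappa ν = n + ∑ i ∈ range (len ν), ((diagram ν).rowLen i : ℤ) ^ 2 -
      2 * ∑ x ∈ (diagram ν).cells, (x.1 : ℤ) - 2 * n := by
    have h6 : ∑ x ∈ (diagram ν).cells, ((x.1 : ℤ) + 1) =
        ∑ i ∈ range (len ν), ((i : ℤ) + 1) * (diagram ν).rowLen i := by
      rw [sum_cells_rows (diagram ν) _ (rowLen_eq_zero_of_len_le ν)]
      refine sum_congr rfl fun i _ => ?_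
      simp [mul_comm]
    rw [sum_add_distrib, sum_const, card_diagram, nsmul_eq_mul, mul_one] at h6
    rw [kappa, ← Ico_add_one_right_eq_Icc, sum_Ico_eq_sum_range, Nat.add_sub_cancel]
    have h7 : ∀ i ∈ range (len ν), ((part ν (1 + i) : ℤ) ^ 2 - 2 * ((1 + i : ℕ) : ℤ) * part ν (1 + i)) =
        ((diagram ν).rowLen i : ℤ) ^ 2 - 2 * (((i : ℤ) + 1) * (diagram ν).rowLen i) := by
      intro i _
      rw [part, Nat.add_sub_cancel_left]
      push_cast
      ring
    rw [sum_congr rfl h7, sum_sub_distrib, ← mul_sum, ← h6]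
    ring
  have h8 : (rowWeight ν : ℤ) = ∑ x ∈ (diagram ν).cells, (x.1 : ℤ) := by
    simp [rowWeight]
  rw [card_diagram] at h2
  rw [sum_sub_distrib, sum_const, card_diagram, ← mul_sum, nsmul_eq_mul, mul_one] at h3
  rw [sum_congr rfl h1]
  simp only [sum_sub_distrib, sum_add_distrib, sum_const, card_diagram, nsmul_eq_mul, mul_one]
    at h3 ⊢
  linarith

theorem prod_Icc_add {M : Type*} [CommMonoid M] (f : ℕ → M) (r m : ℕ) :
    (∏ v ∈ Icc 1 m, f v) * ∏ v ∈ Icc 1 r, f (v + m) = ∏ v ∈ Icc 1 (r + m), f v := by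
  induction r with
  | zero => simp
  | succ r ih =>
    rw [prod_Icc_succ_top (by omega), ← mul_assoc, ih, Nat.add_right_comm r 1 m,
      prod_Icc_succ_top (by omega)]

/-- The product formula for `V_ν` in terms of hook lengths. -/
theorem V_eq_one_div_hookProd {K : Type*} [Field K] (sn : ℂ → K)
    (hsn : ∀ d : ℕ, 1 ≤ d → sn ((d : ℂ) / 2) ≠ 0) [CharZero K] (ν : n.Partition) :
    V sn ν = 1 / hookProd sn ν := by
  set f : ℕ → K := fun d => sn ((d : ℂ) / 2) with hf
  set r := (diagram ν).rowLen with hr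
  have hz := rowLen_eq_zero_of_len_le ν
  set l := len ν with hl
  have hP : ∀ m, ∏ v ∈ Icc 1 m, f v ≠ 0 := fun m =>
    prod_ne_zero_iff.2 fun v hv => hsn v (mem_Icc.1 hv).1
  have h1 : ∏ b ∈ Icc 1 l, ∏ a ∈ Ico 1 b,
      sn (((part ν a : ℂ) - part ν b + b - a) / 2) / sn (((b : ℂ) - a) / 2) =
      ∏ i ∈ range l, (∏ b ∈ Ico (i + 1) l, f (r i - r b + (b - i))) /
        ∏ v ∈ Icc 1 (l - (i + 1)), f v := by
    have h0 : ∀ i ∈ range l, (∏ b ∈ Ico (i + 1) l, f (r i - r b + (b - i))) /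
        ∏ v ∈ Icc 1 (l - (i + 1)), f v =
        ∏ b ∈ Ico (i + 1) l, f (r i - r b + (b - i)) / f (b - i) := by
      intro i _
      rw [prod_div_distrib]
      congr 1
      refine prod_bij' (fun v _ => v + i) (fun b _ => b - i) ?_ ?_ ?_ ?_ ?_
      · intro v hv
        simp only [mem_Icc, mem_Ico] at hv ⊢
        omega
      · intro v hv
        simp only [mem_Icc, mem_Ico] at hv ⊢
        omega
      · intro v _
        simp
      · intro b hb
        have := (mem_Ico.1 hb).1
        omega
      · intro v _
        simp
    rw [prod_congr rfl h0, prod_sigma', prod_sigma']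
    refine prod_bij' (fun p _ => ⟨p.2 - 1, p.1 - 1⟩) (fun p _ => ⟨p.2 + 1, p.1 + 1⟩)
      ?_ ?_ ?_ ?_ ?_
    · rintro ⟨b, a⟩ h
      simp only [mem_sigma, mem_Icc, mem_Ico, mem_range] at h ⊢
      omega
    · rintro ⟨a, b⟩ h
      simp only [mem_sigma, mem_Icc, mem_Ico, mem_range] at h ⊢
      omega
    · rintro ⟨b, a⟩ h
      simp only [mem_sigma, mem_Icc, mem_Ico] at h
      simp only [Sigma.mk.injEq, heq_eq_eq]
      omega
    · rintro ⟨a, b⟩ h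
      simp
    · rintro ⟨b, a⟩ h
      simp only [mem_sigma, mem_Icc, mem_Ico] at h
      obtain ⟨a, rfl⟩ : ∃ c, a = c + 1 := ⟨a - 1, by omega⟩
      obtain ⟨b, rfl⟩ : ∃ c, b = c + 1 := ⟨b - 1, by omega⟩
      have hab : a ≤ b := by omega
      have hrab := (diagram ν).rowLen_anti a b hab
      simp only [hf, part, Nat.add_sub_cancel, hr]
      push_cast [Nat.cast_sub hab, Nat.cast_sub hrab]
      congr 3 <;> ring
  have h2 : ∏ i ∈ Icc 1 l, ∏ v ∈ Icc 1 (part ν i), (2 * sn (((v : ℂ) - i + l) / 2)) =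
      ∏ i ∈ range l, 2 ^ r i * ∏ v ∈ Icc 1 (r i), f (v + (l - (i + 1))) := by
    rw [← Ico_add_one_right_eq_Icc, prod_Ico_eq_prod_range, Nat.add_sub_cancel]
    refine prod_congr rfl fun i hi => ?_
    have hi' := mem_range.1 hi
    rw [prod_mul_distrib, prod_const, Nat.card_Icc, part, Nat.add_sub_cancel_left,
      Nat.add_sub_cancel]
    congr 1
    refine prod_congr rfl fun v _ => ?_
    simp only [hf]
    congr 2
    push_cast [Nat.cast_sub (show i + 1 ≤ l by omega)]
    ring
  rw [V, h1, h2, hookProd, prod_cells_rows (diagram ν) _ hz, one_div, one_div, ← prod_inv_distrib,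
    ← prod_inv_distrib, ← prod_mul_distrib]
  refine prod_congr rfl fun i hi => ?_
  -- Write `P m` for the product of `f` over `1, …, m`, with `k = l - (i + 1)`. Differences times
  -- hooks give `P (r i + k)`, and so does `P k` times the shifted product from `V`; the row
  -- therefore reduces to the inverse of its hooks.
  have h3 := prod_diff_mul_prod_hookLen (diagram ν) f hz (mem_range.1 hi)
  have h4 := prod_Icc_add f (r i) (l - (i + 1))
  have h5 : ∏ j ∈ range (r i), 2 * sn ((hook ν (i, j) : ℂ) / 2) =
      2 ^ r i * ∏ j ∈ range (r i), f (hookLen (diagram ν) i j) := by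
    rw [prod_mul_distrib, prod_const, card_range]
    rfl
  rw [h5]
  have hQ := hP (r i + (l - (i + 1)))
  rw [← h4] at h3 hQ
  have hP1 := hP (l - (i + 1))
  have hP2 := (mul_ne_zero_iff.1 hQ).2
  have hH : ∏ j ∈ range (r i), f (hookLen (diagram ν) i j) ≠ 0 :=
    right_ne_zero_of_mul (h3.trans_ne hQ)
  have h20 : (2 : K) ^ r i ≠ 0 := pow_ne_zero _ two_ne_zero
  field_simp
  rw [← h3]

end

end MarinoVafa

namespace MarinoVafa

noncomputable section

open Finset Equiv

variable {n : ℕ}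

/-! ### Principal specialization -/

theorem prod_fin_Ioi {M : Type*} [CommMonoid M] (N : ℕ) (F : ℕ → ℕ → M) :
    ∏ i : Fin N, ∏ j ∈ Ioi i, F i j = ∏ i ∈ range N, ∏ j ∈ Ico (i + 1) N, F i j := by
  rw [prod_range]
  refine prod_congr rfl fun i _ => ?_
  refine (prod_map (Ioi i) Fin.valEmbedding fun j => F i j).symm.trans ?_
  rw [Fin.map_valEmbedding_Ioi]
  refine prod_congr ?_ fun _ _ => rfl
  ext j
  simp only [mem_Ioo, mem_Ico]
  omega

theorem prod_Ico_sub {M : Type*} [CommMonoid M] (f : ℕ → M) (i N : ℕ) :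
    ∏ b ∈ Ico (i + 1) N, f (b - i) = ∏ v ∈ Icc 1 (N - (i + 1)), f v := by
  refine prod_bij' (fun b _ => b - i) (fun v _ => v + i) ?_ ?_ ?_ ?_ ?_
  · intro v hv
    simp only [mem_Icc, mem_Ico] at hv ⊢
    omega
  · intro v hv
    simp only [mem_Icc, mem_Ico] at hv ⊢
    omega
  · intro b hb
    have := (mem_Ico.1 hb).1
    omega
  · intro v _
    simp
  · intro v _
    simp

theorem prod_prod_pow_eq_rowWeight {K : Type*} [Field K] (q : K) {N : ℕ} (hN : n ≤ N)
    (ν : n.Partition) :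
    ∏ i ∈ range N, ∏ j ∈ Ico (i + 1) N, q ^ (diagram ν).rowLen j = q ^ rowWeight ν := by
  rw [prod_comm' (t' := range N) (s' := fun j => range j)]
  · simp only [prod_const, card_range, ← pow_mul]
    rw [prod_pow_eq_pow_sum, rowWeight,
      sum_cells_rows (diagram ν) _ fun i hi => rowLen_eq_zero ν (hN.trans hi)]
    simp
  · intro i j
    simp only [mem_range, mem_Ico]
    omega

section

variable {K : Type*} [Field K] {q : K}

/-- Each difference is its smaller power times some `1 - q^d`; the extra powers collect to
`q^{n(ν)}`, and the row identity trades the differences for hooks. In the ratio to the staircase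
product, `N` enters only through `q^N`. The content `x.2 - x.1` may be negative, hence the quotient
of powers. -/
theorem prod_shifted_sub (hq0 : q ≠ 0) (hq : ∀ d, 1 ≤ d → q ^ d ≠ 1) {N : ℕ} (hN : n ≤ N)
    (ν : n.Partition) :
    ∏ i : Fin N, ∏ j ∈ Ioi i, (q ^ shifted ν j - q ^ shifted ν i) =
      (∏ i : Fin N, ∏ j ∈ Ioi i, (q ^ (Fin.rev j : ℕ) - q ^ (Fin.rev i : ℕ))) *
        (q ^ rowWeight ν * ∏ x ∈ (diagram ν).cells,
          ((1 - q ^ N * (q ^ x.2 / q ^ x.1)) * (1 - q ^ hook ν x)⁻¹)) := by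
  set r := (diagram ν).rowLen with hr
  set f : ℕ → K := fun d => 1 - q ^ d with hf
  have hf0 : ∀ d, 1 ≤ d → f d ≠ 0 := fun d hd => sub_ne_zero.2 (hq d hd).symm
  have hz : ∀ i, N ≤ i → (diagram ν).rowLen i = 0 := fun i hi => rowLen_eq_zero ν (hN.trans hi)
  have h1 : ∏ i : Fin N, ∏ j ∈ Ioi i, (q ^ shifted ν j - q ^ shifted ν i) =
      ∏ i ∈ range N, ∏ j ∈ Ico (i + 1) N,
        (q ^ r j * q ^ (N - (j + 1)) * f (r i - r j + (j - i))) := by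
    simp only [shifted, Fin.val_rev]
    rw [prod_fin_Ioi N fun i j => q ^ ((diagram ν).rowLen j + (N - (j + 1))) -
      q ^ ((diagram ν).rowLen i + (N - (i + 1)))]
    refine prod_congr rfl fun i _ => prod_congr rfl fun j hj => ?_
    have hj' := mem_Ico.1 hj
    have h2 := (diagram ν).rowLen_anti i j (by omega)
    have h3 : (diagram ν).rowLen i + (N - (i + 1)) =
        r j + (N - (j + 1)) + (r i - r j + (j - i)) := by
      simp only [hr]
      omega
    rw [h3, pow_add _ (r j + _), pow_add _ (r j)]
    simp only [hf, hr]
    ring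
  have h2 : ∏ i : Fin N, ∏ j ∈ Ioi i, (q ^ (Fin.rev j : ℕ) - q ^ (Fin.rev i : ℕ)) =
      ∏ i ∈ range N, ∏ j ∈ Ico (i + 1) N, (q ^ (N - (j + 1)) * f (j - i)) := by
    simp only [Fin.val_rev]
    rw [prod_fin_Ioi N fun i j => q ^ (N - (j + 1)) - q ^ (N - (i + 1))]
    refine prod_congr rfl fun i _ => prod_congr rfl fun j hj => ?_
    have hj' := mem_Ico.1 hj
    have h3 : N - (i + 1) = N - (j + 1) + (j - i) := by omega
    rw [h3, pow_add]
    simp only [hf]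
    ring
  have h3 : ∏ x ∈ (diagram ν).cells, ((1 - q ^ N * (q ^ x.2 / q ^ x.1)) * (1 - q ^ hook ν x)⁻¹) =
      ∏ i ∈ range N, ((∏ v ∈ Icc 1 (r i), f (v + (N - (i + 1)))) *
        (∏ j ∈ range (r i), f (hookLen (diagram ν) i j))⁻¹) := by
    rw [prod_cells_rows (diagram ν) _ hz]
    refine prod_congr rfl fun i hi => ?_
    have hi' := mem_range.1 hi
    rw [prod_mul_distrib, prod_inv_distrib]
    congr 1
    rw [← Ico_add_one_right_eq_Icc, prod_Ico_eq_prod_range, Nat.add_sub_cancel]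
    refine prod_congr rfl fun j _ => ?_
    have h4 : q ^ (1 + j + (N - (i + 1))) * q ^ i = q ^ N * q ^ j := by
      rw [← pow_add, ← pow_add]
      congr 1
      omega
    simp only [hf]
    rw [← mul_div_assoc, ← h4, mul_div_cancel_right₀ _ (pow_ne_zero _ hq0)]
  rw [h1, h2, h3, ← prod_prod_pow_eq_rowWeight q hN ν, ← prod_mul_distrib, ← prod_mul_distrib]
  refine prod_congr rfl fun i hi => ?_
  have h4 := prod_diff_mul_prod_hookLen (diagram ν) f hz (mem_range.1 hi)
  have h5 := prod_Icc_add f (r i) (N - (i + 1))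
  have h6 : ∏ j ∈ range (r i), f (hookLen (diagram ν) i j) ≠ 0 := by
    refine right_ne_zero_of_mul (h4.trans_ne ?_)
    exact prod_ne_zero_iff.2 fun v hv => hf0 v (mem_Icc.1 hv).1
  rw [← h5] at h4
  simp only [prod_mul_distrib]
  rw [prod_Ico_sub, eq_div_of_mul_eq h6 h4]
  field_simp
  simp only [hr]
  ring

theorem sum_geometric (hq : ∀ d, 1 ≤ d → q ^ d ≠ 1) (N : ℕ) {d : ℕ} (hd : 1 ≤ d) :
    ∑ i : Fin N, (q ^ (i : ℕ)) ^ d = (1 - (q ^ N) ^ d) * (1 - q ^ d)⁻¹ := by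
  have h1 : ∀ i : ℕ, (q ^ i) ^ d = (q ^ d) ^ i := fun i => pow_right_comm q i d
  simp only [h1]
  rw [← sum_range fun i => (q ^ d) ^ i, geom_sum_eq (hq d hd), ← neg_sub 1 (q ^ d),
    ← neg_sub 1 ((q ^ d) ^ N), neg_div_neg_eq, div_eq_mul_inv]

/-- The expansion of a product of power sums into Schur functions, at the infinite geometric
progression `1, q, q², …`. -/
theorem prod_inv_one_sub_pow [Algebra ℂ K] (hq0 : q ≠ 0) (hq : ∀ d, 1 ≤ d → q ^ d ≠ 1)
    (g : Perm (Fin n)) :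
    (g.partition.parts.map fun d => (1 - q ^ d)⁻¹).prod =
      ∑ ν : n.Partition, algebraMap ℂ K (spechtChar ν g) *
        (q ^ rowWeight ν * ∏ x ∈ (diagram ν).cells, (1 - q ^ hook ν x)⁻¹) := by
  -- `P` and `S` are the two sides for `N` variables with `q^N` made an indeterminate. They agree at
  -- all `q^N` with `N ≥ n`, infinitely many points since no positive power of `q` is `1`; the claim
  -- is their value at `0`.
  set P : Polynomial K := (g.partition.parts.map fun d =>
    (1 - Polynomial.X ^ d) * Polynomial.C (1 - q ^ d)⁻¹).prod with hP
  set S : Polynomial K := ∑ ν : n.Partition, Polynomial.C (algebraMap ℂ K (spechtChar ν g)) *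
    (Polynomial.C (q ^ rowWeight ν) * ∏ x ∈ (diagram ν).cells,
      ((1 - Polynomial.X * Polynomial.C (q ^ x.2 / q ^ x.1)) *
        Polynomial.C (1 - q ^ hook ν x)⁻¹)) with hS
  have hevP : ∀ y, P.eval y = (g.partition.parts.map fun d =>
      (1 - y ^ d) * (1 - q ^ d)⁻¹).prod := by
    intro y
    rw [hP, Polynomial.eval_multiset_prod, Multiset.map_map]
    simp
  have hevS : ∀ y, S.eval y = ∑ ν : n.Partition, algebraMap ℂ K (spechtChar ν g) *
      (q ^ rowWeight ν * ∏ x ∈ (diagram ν).cells,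
        ((1 - y * (q ^ x.2 / q ^ x.1)) * (1 - q ^ hook ν x)⁻¹)) := by
    intro y
    rw [hS, Polynomial.eval_finsetSum]
    simp only [Polynomial.eval_mul, Polynomial.eval_C, Polynomial.eval_prod, Polynomial.eval_sub,
      Polynomial.eval_one, Polynomial.eval_X]
  have heq : ∀ N, n ≤ N → P.eval (q ^ N) = S.eval (q ^ N) := by
    intro N hN
    have h1 := prod_powerSum_geometric hN q g
    simp_rw [prod_shifted_sub hq0 hq hN] at h1
    have h2 : ∏ i : Fin N, ∏ j ∈ Ioi i, (q ^ (Fin.rev j : ℕ) - q ^ (Fin.rev i : ℕ)) ≠ 0 := by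
      refine prod_ne_zero_iff.2 fun i _ => prod_ne_zero_iff.2 fun j hj => ?_
      have h3 : (Fin.rev j : ℕ) < Fin.rev i := Fin.rev_lt_rev.2 (mem_Ioi.1 hj)
      obtain ⟨d, hd⟩ := Nat.exists_eq_add_of_lt h3
      rw [hd, Nat.add_assoc, pow_add, ← mul_one_sub]
      exact mul_ne_zero (pow_ne_zero _ hq0) (sub_ne_zero.2 (hq _ (by omega)).symm)
    rw [hevP, hevS]
    refine Eq.trans ?_ (mul_left_cancel₀ h2 (h1.trans
      ((sum_congr rfl fun _ _ => mul_left_comm _ _ _).trans (mul_sum _ _ _).symm)))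
    congr 1
    refine Multiset.map_congr rfl fun d hd => ?_
    rw [sum_geometric hq N (g.partition.parts_pos hd)]
  have hinj : Function.Injective fun N : ℕ => q ^ N := by
    have key : ∀ a b : ℕ, a < b → q ^ a ≠ q ^ b := by
      intro a b hab h
      obtain ⟨d, rfl⟩ := Nat.exists_eq_add_of_lt hab
      rw [Nat.add_assoc, pow_add, left_eq_mul₀ (pow_ne_zero _ hq0)] at h
      exact hq _ (by omega) h
    intro a b h
    rcases lt_trichotomy a b with h1 | h1 | h1
    · exact absurd h (key a b h1)
    · exact h1
    · exact absurd h.symm (key b a h1)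
  have hPS : P = S := by
    refine Polynomial.eq_of_infinite_eval_eq P S (Set.Infinite.mono (s := (fun N : ℕ => q ^ N) ''
      Set.Ici n) ?_ ((Set.infinite_coe_iff.1 (Set.Ici_infinite n).to_subtype).image hinj.injOn))
    rintro _ ⟨N, hN, rfl⟩
    exact heq N hN
  have h0 := hevP 0
  rw [hPS, hevS] at h0
  simp only [zero_mul, sub_zero, one_mul] at h0
  rw [h0]
  refine congrArg _ (Multiset.map_congr rfl fun d hd => ?_)
  rw [zero_pow (g.partition.parts_pos hd).ne', sub_zero, one_mul]

end

end

end MarinoVafa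

namespace MarinoVafa

noncomputable section

open Finset Equiv

/-! ### Exponential and logarithmic series in the power sums -/

section Series

variable {K : Type*} [Field K]

/-- The coefficients of `exp (∑_d a_d p_d)`. -/
def expCoeff (a : ℕ+ → K) (m : ℕ+ →₀ ℕ) : K := m.prod fun d k => a d ^ k / k.factorial

/-- The series `∑_d a_d p_d`. -/
def linearSeries (a : ℕ+ → K) : MvPowerSeries ℕ+ K :=
  fun m => ∑ d ∈ m.support, a d * if m = Finsupp.single d 1 then 1 else 0

theorem coeff_linearSeries_single (a : ℕ+ → K) (d : ℕ+) :
    MvPowerSeries.coeff (Finsupp.single d 1) (linearSeries a) = a d := by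
  change ∑ e ∈ (Finsupp.single d 1).support, _ = _
  rw [Finsupp.support_single _ one_ne_zero, sum_singleton, if_pos rfl, mul_one]

theorem coeff_linearSeries_eq_zero (a : ℕ+ → K) {m : ℕ+ →₀ ℕ}
    (hm : ∀ d, m ≠ Finsupp.single d 1) : MvPowerSeries.coeff m (linearSeries a) = 0 :=
  sum_eq_zero fun d _ => by rw [if_neg (hm d), mul_zero]

theorem constantCoeff_linearSeries (a : ℕ+ → K) :
    MvPowerSeries.constantCoeff (linearSeries a) = 0 := by
  rw [← MvPowerSeries.coeff_zero_eq_constantCoeff_apply]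
  exact coeff_linearSeries_eq_zero a fun d h => by
    simpa using congrArg (fun f : ℕ+ →₀ ℕ => f d) h

/-- The coefficient form of `∂/∂p_d exp(∑ a_e p_e) = a_d exp(∑ a_e p_e)`; summed over `d` it drives
the multinomial expansion below. -/
theorem mul_expCoeff_sub [CharZero K] (a : ℕ+ → K) {m : ℕ+ →₀ ℕ} {d : ℕ+} (hd : d ∈ m.support) :
    a d * expCoeff a (m - Finsupp.single d 1) = m d * expCoeff a m := by
  have hsub : (m - Finsupp.single d 1).support ⊆ m.support := Finsupp.support_tsub
  rw [expCoeff, expCoeff, Finsupp.prod_of_support_subset _ hsub _ (by simp), Finsupp.prod,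
    ← mul_prod_erase _ _ hd, ← mul_prod_erase _ _ hd, ← mul_assoc, ← mul_assoc]
  congr 1
  · obtain ⟨k, hk⟩ : ∃ k, m d = k + 1 :=
      Nat.exists_eq_add_of_le' (Nat.pos_of_ne_zero (Finsupp.mem_support_iff.1 hd))
    have h1 : (k.factorial : K) ≠ 0 := Nat.cast_ne_zero.2 k.factorial_ne_zero
    have h2 : (k + 1 : K) ≠ 0 := Nat.cast_add_one_ne_zero k
    rw [Finsupp.tsub_apply, Finsupp.single_eq_same, hk, Nat.add_sub_cancel, Nat.factorial_succ]
    push_cast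
    field_simp
    ring
  · refine prod_congr rfl fun e he => ?_
    rw [Finsupp.tsub_apply, Finsupp.single_eq_of_ne (ne_of_mem_erase he), Nat.sub_zero]

theorem coeff_linearSeries_pow [CharZero K] (a : ℕ+ → K) (k : ℕ) (m : ℕ+ →₀ ℕ) :
    MvPowerSeries.coeff m (linearSeries a ^ k) =
      if m.degree = k then k.factorial * expCoeff a m else 0 := by
  classical
  induction k generalizing m with
  | zero =>
    rw [pow_zero, MvPowerSeries.coeff_one]
    by_cases hm : m = 0
    · simp [hm, expCoeff]
    · rw [if_neg hm, if_neg]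
      simpa [Finsupp.degree_eq_zero_iff] using hm
  | succ k ih =>
    have h1 : MvPowerSeries.coeff m (linearSeries a ^ (k + 1)) = ∑ d ∈ m.support,
        a d * MvPowerSeries.coeff (m - Finsupp.single d 1) (linearSeries a ^ k) := by
      rw [pow_succ', MvPowerSeries.coeff_mul]
      symm
      refine sum_of_injOn (fun d => (Finsupp.single d 1, m - Finsupp.single d 1)) ?_ ?_ ?_ ?_
      · intro d _ e _ h
        exact Finsupp.single_left_injective one_ne_zero (Prod.ext_iff.1 h).1
      · intro d hd
        rw [mem_coe, HasAntidiagonal.mem_antidiagonal]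
        refine add_tsub_cancel_of_le (Finsupp.single_le_iff.2 ?_)
        exact Nat.pos_of_ne_zero (Finsupp.mem_support_iff.1 hd)
      · rintro ⟨p, q⟩ hpq hnot
        rw [HasAntidiagonal.mem_antidiagonal] at hpq
        rw [coeff_linearSeries_eq_zero, zero_mul]
        rintro d rfl
        refine hnot ⟨d, ?_, ?_⟩
        · rw [mem_coe, Finsupp.mem_support_iff, ← hpq]
          simp
        · dsimp only at hpq ⊢
          rw [← hpq, add_tsub_cancel_left]
      · intro d _
        rw [coeff_linearSeries_single]
    have hdeg : ∀ d ∈ m.support, (m - Finsupp.single d 1).degree + 1 = m.degree := by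
      intro d hd
      have h2 : Finsupp.single d 1 + (m - Finsupp.single d 1) = m :=
        add_tsub_cancel_of_le (Finsupp.single_le_iff.2
          (Nat.pos_of_ne_zero (Finsupp.mem_support_iff.1 hd)))
      have h3 := congrArg Finsupp.degree h2
      rw [map_add, Finsupp.degree_single] at h3
      omega
    rw [h1]
    by_cases hm : m.degree = k + 1
    · rw [if_pos hm]
      have h4 : ∀ d ∈ m.support, a d * MvPowerSeries.coeff (m - Finsupp.single d 1)
          (linearSeries a ^ k) = m d * (k.factorial * expCoeff a m) := by
        intro d hd
        have := hdeg d hd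
        rw [ih, if_pos (by omega), mul_left_comm, mul_expCoeff_sub a hd, mul_left_comm]
      rw [sum_congr rfl h4, ← sum_mul, ← Nat.cast_sum]
      have h5 : ∑ d ∈ m.support, m d = k + 1 := hm
      rw [h5, Nat.factorial_succ]
      push_cast
      ring
    · rw [if_neg hm]
      refine sum_eq_zero fun d hd => ?_
      have := hdeg d hd
      rw [ih, if_neg (by omega), mul_zero]

variable [Algebra ℚ K]

theorem coeff_subst_exp_linearSeries (a : ℕ+ → K) (m : ℕ+ →₀ ℕ) :
    MvPowerSeries.coeff m (PowerSeries.subst (linearSeries a) (PowerSeries.exp K)) =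
      expCoeff a m := by
  have : CharZero K := algebraRat.charZero K
  rw [PowerSeries.coeff_subst
    (PowerSeries.HasSubst.of_constantCoeff_zero (constantCoeff_linearSeries a)),
    finsum_eq_single _ m.degree]
  · rw [coeff_linearSeries_pow, if_pos rfl, PowerSeries.coeff_exp, smul_eq_mul]
    have h : (m.degree.factorial : K) ≠ 0 := Nat.cast_ne_zero.2 (Nat.factorial_ne_zero _)
    rw [map_div₀, map_one, map_natCast]
    field_simp
  · intro k hk
    rw [coeff_linearSeries_pow, if_neg hk.symm, smul_zero]

/-- Both sides have constant term zero. Substituting `exp - 1` into `log' · (1 + X) = 1` shows by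
the chain rule that both have derivative `1`. -/
theorem subst_exp_sub_one_log :
    PowerSeries.subst (PowerSeries.exp K - 1) (PowerSeries.log K) = PowerSeries.X := by
  have : CharZero K := algebraRat.charZero K
  have hs : PowerSeries.HasSubst (PowerSeries.exp K - 1) := PowerSeries.HasSubst.exp_sub_one
  refine PowerSeries.derivative.ext ?_ ?_
  · rw [PowerSeries.derivative_subst hs, map_sub, PowerSeries.derivative_exp,
      PowerSeries.derivative_one, sub_zero, PowerSeries.derivative_X]
    have h1 : PowerSeries.derivative K (PowerSeries.log K) * (1 + PowerSeries.X) = 1 := by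
      rw [PowerSeries.deriv_log]
      ext k
      rw [mul_add, mul_one, map_add]
      cases k with
      | zero => simp
      | succ k => simp [PowerSeries.coeff_succ_mul_X, pow_succ, PowerSeries.coeff_one]
    have h2 := congrArg (PowerSeries.subst (PowerSeries.exp K - 1)) h1
    rw [PowerSeries.subst_mul hs, PowerSeries.subst_add hs, PowerSeries.subst_X hs] at h2
    have h3 : PowerSeries.subst (PowerSeries.exp K - 1) (1 : PowerSeries K) =
        (1 : PowerSeries K) := by
      rw [← PowerSeries.coe_substAlgHom hs, map_one]
    rw [h3, add_sub_cancel] at h2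
    exact h2
  · rw [PowerSeries.constantCoeff_X]
    exact PowerSeries.constantCoeff_subst_eq_zero (by simp [← PowerSeries.constantCoeff_eq]) _
      PowerSeries.constantCoeff_log

theorem log_subst_exp_linearSeries (a : ℕ+ → K) :
    PowerSeries.subst (PowerSeries.subst (linearSeries a) (PowerSeries.exp K) - 1)
      (PowerSeries.log K) = linearSeries a := by
  have hC : PowerSeries.HasSubst (linearSeries a) :=
    PowerSeries.HasSubst.of_constantCoeff_zero (constantCoeff_linearSeries a)
  have hs : PowerSeries.HasSubst (PowerSeries.exp K - 1) := PowerSeries.HasSubst.exp_sub_one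
  have h1 : PowerSeries.subst (linearSeries a) (PowerSeries.exp K) - 1 =
      PowerSeries.subst (linearSeries a) (PowerSeries.exp K - 1) := by
    rw [PowerSeries.subst_sub hC]
    congr 1
    rw [← PowerSeries.coe_substAlgHom hC, map_one]
  rw [h1, ← PowerSeries.subst_comp_subst_apply hs hC, subst_exp_sub_one_log,
    PowerSeries.subst_X hC]

/-- The coefficients of the logarithm as sums over tuples of nonzero exponents. -/
theorem coeff_logSeries [Algebra ℂ K] {F : MvPowerSeries ℕ+ K}
    (hF : MvPowerSeries.constantCoeff F = 1) (m : ℕ+ →₀ ℕ) :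
    MvPowerSeries.coeff m (logSeries F) =
      ∑ k ∈ Icc 1 m.degree, algebraMap ℂ K ((-1) ^ (k - 1) / k) *
        ∑ f ∈ (univ : Finset (Fin k)).piAntidiag m with ∀ i, f i ≠ 0,
          ∏ i, MvPowerSeries.coeff (f i) F := by
  classical
  have h0 : MvPowerSeries.constantCoeff (F - 1) = 0 := by rw [map_sub, hF, map_one, sub_self]
  have hpow : ∀ k, MvPowerSeries.coeff m ((F - 1) ^ k) =
      ∑ f ∈ (univ : Finset (Fin k)).piAntidiag m with ∀ i, f i ≠ 0,
        ∏ i, MvPowerSeries.coeff (f i) F := by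
    intro k
    have h1 : (F - 1) ^ k = ∏ _i : Fin k, (F - 1) := by simp
    rw [h1, MvPowerSeries.coeff_prod, sum_filter]
    refine sum_bij' (fun l _ => l) (fun f _ => Finsupp.equivFunOnFinite.symm f) ?_ ?_ (by simp)
      (by simp) ?_
    · intro f hf
      simpa using hf
    · intro f hf
      simpa using hf
    · intro l _
      split_ifs with h
      · refine prod_congr rfl fun i _ => ?_
        rw [map_sub, MvPowerSeries.coeff_one, if_neg (h i), sub_zero]
      · obtain ⟨i, hi⟩ := not_forall.1 h
        refine prod_eq_zero (mem_univ i) ?_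
        rw [not_not.1 hi, MvPowerSeries.coeff_zero_eq_constantCoeff_apply, h0]
  -- A sum of `k` nonzero exponents has degree at least `k`, so the logarithm contributes finitely
  -- many terms at `m`.
  have hempty : ∀ k, m.degree < k → MvPowerSeries.coeff m ((F - 1) ^ k) = 0 := by
    intro k hk
    rw [hpow]
    refine sum_eq_zero fun f hf => ?_
    obtain ⟨h1, h2⟩ := mem_filter.1 hf
    have h3 := congrArg Finsupp.degree (mem_piAntidiag.1 h1).1
    rw [map_sum] at h3
    have h4 : ∑ _i : Fin k, 1 ≤ ∑ i, (f i).degree := sum_le_sum fun i _ =>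
      Nat.one_le_iff_ne_zero.2 fun h => h2 i ((Finsupp.degree_eq_zero_iff _).1 h)
    simp only [sum_const, card_univ, Fintype.card_fin, smul_eq_mul, mul_one] at h4
    omega
  rw [logSeries, PowerSeries.coeff_subst (PowerSeries.HasSubst.of_constantCoeff_zero h0),
    finsum_eq_sum_of_support_subset (s := Icc 1 m.degree)]
  · refine sum_congr rfl fun k hk => ?_
    have hk1 := (mem_Icc.1 hk).1
    rw [hpow, PowerSeries.coeff_log, if_neg (by omega), smul_eq_mul]
    congr 1
    obtain ⟨k, rfl⟩ := Nat.exists_eq_add_of_le' hk1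
    rw [Nat.add_sub_cancel, map_div₀, map_div₀, map_natCast, map_natCast]
    simp [pow_succ]
  · intro k hk
    rw [Function.mem_support] at hk
    rw [coe_Icc, Set.mem_Icc]
    by_contra h
    apply hk
    rcases Nat.eq_zero_or_pos k with rfl | hk0
    · simp
    · rw [hempty k (by omega), smul_zero]

end Series

end

end MarinoVafa

namespace MarinoVafa

noncomputable section

open Finset Equiv

/-! ### The hook series for abstract exponential and sine functions -/

section Generic

variable {K : Type*} [Field K] {ex sn : ℂ → K}

theorem exp_nat_mul (hadd : ∀ a b, ex (a + b) = ex a * ex b) (h0 : ex 0 = 1) (a : ℂ) (k : ℕ) :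
    ex (k * a) = ex a ^ k := by
  induction k with
  | zero => simpa using h0
  | succ k ih => rw [Nat.cast_succ, add_mul, one_mul, hadd, ih, pow_succ]

theorem exp_sum (hadd : ∀ a b, ex (a + b) = ex a * ex b) (h0 : ex 0 = 1) {ι : Type*}
    (s : Finset ι) (f : ι → ℂ) : ex (∑ i ∈ s, f i) = ∏ i ∈ s, ex (f i) := by
  classical
  induction s using Finset.induction_on with
  | empty => simpa using h0
  | insert i s hi ih => rw [sum_insert hi, prod_insert hi, hadd, ih]

theorem exp_ne_zero (hadd : ∀ a b, ex (a + b) = ex a * ex b) (h0 : ex 0 = 1) (a : ℂ) :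
    ex a ≠ 0 := by
  intro h
  have h1 := hadd a (-a)
  rw [add_neg_cancel, h0, h, zero_mul] at h1
  exact one_ne_zero h1

variable [Algebra ℂ K]

theorem algebraMap_I_mul_self :
    algebraMap ℂ K Complex.I * algebraMap ℂ K Complex.I = -1 := by
  rw [← map_mul, Complex.I_mul_I, map_neg, map_one]

/-- With `q = ex (-√-1)`, each sine splits into a half-integral power of `q` and a factor `1 - q^d`;
only the latter enters the principal specialization. -/
theorem two_mul_sin_half (hadd : ∀ a b, ex (a + b) = ex a * ex b) (h0 : ex 0 = 1)
    (hsin : ∀ a, 2 * algebraMap ℂ K Complex.I * sn a = ex (Complex.I * a) - ex (-Complex.I * a))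
    (d : ℕ) : 2 * sn ((d : ℂ) / 2) =
      -algebraMap ℂ K Complex.I * ex (Complex.I * (d / 2)) * (1 - ex (-Complex.I) ^ d) := by
  have h1 : ex (-Complex.I * (d / 2)) = ex (Complex.I * (d / 2)) * ex (-Complex.I) ^ d := by
    rw [← exp_nat_mul hadd h0, ← hadd]
    congr 1
    ring
  have h2 := hsin ((d : ℂ) / 2)
  rw [h1] at h2
  linear_combination (-algebraMap ℂ K Complex.I) * h2 +
    2 * sn ((d : ℂ) / 2) * algebraMap_I_mul_self (K := K)

theorem exp_neg_I_pow_ne_one [CharZero K] (hadd : ∀ a b, ex (a + b) = ex a * ex b) (h0 : ex 0 = 1)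
    (hsin : ∀ a, 2 * algebraMap ℂ K Complex.I * sn a = ex (Complex.I * a) - ex (-Complex.I * a))
    (hsn : ∀ d : ℕ, 1 ≤ d → sn ((d : ℂ) / 2) ≠ 0) (d : ℕ) (hd : 1 ≤ d) :
    ex (-Complex.I) ^ d ≠ 1 := by
  intro h
  have h1 := two_mul_sin_half hadd h0 hsin d
  rw [h, sub_self, mul_zero] at h1
  exact hsn d hd ((mul_eq_zero.1 h1).resolve_left two_ne_zero)

theorem inv_two_mul_sin_half (hadd : ∀ a b, ex (a + b) = ex a * ex b) (h0 : ex 0 = 1)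
    (hsin : ∀ a, 2 * algebraMap ℂ K Complex.I * sn a = ex (Complex.I * a) - ex (-Complex.I * a))
    (d : ℕ) : (2 * sn ((d : ℂ) / 2))⁻¹ =
      algebraMap ℂ K Complex.I * ex (-Complex.I * (d / 2)) * (1 - ex (-Complex.I) ^ d)⁻¹ := by
  rw [two_mul_sin_half hadd h0 hsin, mul_inv, mul_inv]
  congr 2
  · exact inv_eq_of_mul_eq_one_right (by rw [neg_mul, algebraMap_I_mul_self, neg_neg])
  · refine inv_eq_of_mul_eq_one_right ?_
    rw [← hadd, ← h0]
    congr 1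
    ring

/-- The framing factor turns the hook product into a principal specialization. -/
theorem exp_kappa_div_hookProd (hadd : ∀ a b, ex (a + b) = ex a * ex b) (h0 : ex 0 = 1)
    (hsin : ∀ a, 2 * algebraMap ℂ K Complex.I * sn a = ex (Complex.I * a) - ex (-Complex.I * a))
    {n : ℕ} (ν : n.Partition) :
    ex (1 / 4 * kappa ν * Complex.I) / hookProd sn ν =
      (algebraMap ℂ K Complex.I * ex (-Complex.I / 2)) ^ n *
        (ex (-Complex.I) ^ rowWeight ν *
          ∏ x ∈ (diagram ν).cells, (1 - ex (-Complex.I) ^ hook ν x)⁻¹) := by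
  have h1 : (hookProd sn ν)⁻¹ = algebraMap ℂ K Complex.I ^ n *
      ex (∑ x ∈ (diagram ν).cells, -Complex.I * ((hook ν x : ℂ) / 2)) *
        ∏ x ∈ (diagram ν).cells, (1 - ex (-Complex.I) ^ hook ν x)⁻¹ := by
    rw [hookProd, ← prod_inv_distrib,
      prod_congr rfl fun x _ => inv_two_mul_sin_half hadd h0 hsin (hook ν x),
      prod_mul_distrib, prod_mul_distrib, prod_const, card_diagram, exp_sum hadd h0]
  -- By `two_mul_sum_hook`, `κ/4 - ∑ h/2 = -(n(ν) + n/2)`, so `κ` drops out.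
  have h2 : ex (1 / 4 * kappa ν * Complex.I) *
      ex (∑ x ∈ (diagram ν).cells, -Complex.I * ((hook ν x : ℂ) / 2)) =
      ex (-Complex.I / 2) ^ n * ex (-Complex.I) ^ rowWeight ν := by
    rw [← exp_nat_mul hadd h0, ← exp_nat_mul hadd h0, ← hadd, ← hadd]
    congr 1
    have h3 := congrArg (Int.cast : ℤ → ℂ) (two_mul_sum_hook ν)
    push_cast at h3
    rw [← mul_sum, ← sum_div]
    linear_combination (-Complex.I / 4) * h3
  rw [div_eq_mul_inv, h1, mul_pow]
  linear_combination algebraMap ℂ K Complex.I ^ n *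
    (∏ x ∈ (diagram ν).cells, (1 - ex (-Complex.I) ^ hook ν x)⁻¹) * h2

theorem prod_map_parts_toPartition {M : Type*} [CommMonoid M] (F : ℕ → M) (m : ℕ+ →₀ ℕ) :
    ((toPartition m).parts.map F).prod = m.prod fun d k => F d ^ k := by
  change (Multiset.mapAddMonoidHom F (∑ d ∈ m.support, Multiset.replicate (m d) (d : ℕ))).prod = _
  rw [map_sum, Multiset.prod_sum]
  refine prod_congr rfl fun d _ => ?_
  simp

variable (sn) in
/-- The coefficients of the logarithm of the hook series. -/
def logCoeff (d : ℕ+) : K :=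
  -(algebraMap ℂ K (Complex.I ^ ((d : ℕ) + 1)) / (2 * ((d : ℕ) : K) * sn (((d : ℕ) : ℂ) / 2)))

theorem closedForm_eq_linearSeries : closedForm sn = linearSeries (logCoeff sn) := by
  funext m
  rw [closedForm, linearSeries, ← sum_neg_distrib]
  refine sum_congr rfl fun d _ => ?_
  rw [logCoeff, MvPowerSeries.coeff_X, neg_mul]

theorem logCoeff_eq (hadd : ∀ a b, ex (a + b) = ex a * ex b) (h0 : ex 0 = 1)
    (hsin : ∀ a, 2 * algebraMap ℂ K Complex.I * sn a = ex (Complex.I * a) - ex (-Complex.I * a))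
    (d : ℕ+) : logCoeff sn d = (algebraMap ℂ K Complex.I * ex (-Complex.I / 2)) ^ (d : ℕ) *
      (1 - ex (-Complex.I) ^ (d : ℕ))⁻¹ / (d : ℕ) := by
  have h1 := inv_two_mul_sin_half hadd h0 hsin d
  have h2 : ex (-Complex.I * ((d : ℕ) / 2)) = ex (-Complex.I / 2) ^ (d : ℕ) := by
    rw [← exp_nat_mul hadd h0]
    congr 1
    ring
  rw [h2] at h1
  rw [logCoeff, mul_right_comm, ← div_div, div_eq_mul_inv _ (2 * sn _), h1, map_pow, pow_succ,
    mul_pow, ← neg_div]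
  congr 1
  linear_combination (-(algebraMap ℂ K Complex.I ^ (d : ℕ) * ex (-Complex.I / 2) ^ (d : ℕ) *
    (1 - ex (-Complex.I) ^ (d : ℕ))⁻¹)) * algebraMap_I_mul_self (K := K)

/-- The sum over shapes is the Schur expansion scaled by `c^{|μ|}`, hence a product over the parts
of `μ`. The factors `k! d^k` of `z_μ` turn the contribution of a part `d` of multiplicity `k` into
`a_d^k / k!`. -/
theorem coeff_hookSeries [CharZero K] (hadd : ∀ a b, ex (a + b) = ex a * ex b) (h0 : ex 0 = 1)
    (hsin : ∀ a, 2 * algebraMap ℂ K Complex.I * sn a = ex (Complex.I * a) - ex (-Complex.I * a))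
    (hsn : ∀ d : ℕ, 1 ≤ d → sn ((d : ℂ) / 2) ≠ 0) (m : ℕ+ →₀ ℕ) :
    MvPowerSeries.coeff m (hookSeries ex sn) = expCoeff (logCoeff sn) m := by
  have hparts := (exists_perm_cycleType (toPartition m)).choose_spec
  have hmain := prod_inv_one_sub_pow (exp_ne_zero hadd h0 (-Complex.I))
    (exp_neg_I_pow_ne_one hadd h0 hsin hsn) (exists_perm_cycleType (toPartition m)).choose
  rw [hparts] at hmain
  set c := algebraMap ℂ K Complex.I * ex (-Complex.I / 2) with hc
  have h1 : MvPowerSeries.coeff m (hookSeries ex sn) = c ^ size m *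
      ((toPartition m).parts.map fun d => (1 - ex (-Complex.I) ^ d)⁻¹).prod / zee m := by
    rw [hmain, mul_sum, sum_div]
    change ∑ ν : (size m).Partition, _ = _
    refine sum_congr rfl fun ν _ => ?_
    rw [exp_kappa_div_hookProd hadd h0 hsin, map_div₀, map_natCast]
    change _ * (algebraMap ℂ K (spechtChar ν _) / _) = _
    ring
  have h2 : c ^ size m = m.prod fun d k => (c ^ (d : ℕ)) ^ k := by
    rw [size, Finsupp.sum, ← prod_pow_eq_pow_sum]
    refine prod_congr rfl fun d _ => ?_
    dsimp only
    rw [← pow_mul, mul_comm]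
  rw [h1, prod_map_parts_toPartition, h2, zee, Finsupp.prod, Finsupp.prod, Finsupp.prod,
    Nat.cast_prod, ← prod_mul_distrib, ← prod_div_distrib]
  refine prod_congr rfl fun d _ => ?_
  dsimp only
  rw [logCoeff_eq hadd h0 hsin, ← hc, div_pow, mul_pow (c ^ (d : ℕ)), Nat.cast_mul, Nat.cast_pow, div_div, mul_comm
    ((Nat.factorial _ : ℕ) : K)]

theorem RBullet_zero [CharZero K] (hsn : ∀ d : ℕ, 1 ≤ d → sn ((d : ℂ) / 2) ≠ 0) :
    RBullet ex sn 0 = hookSeries ex sn := by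
  funext m
  change ∑ ν : (size m).Partition, _ = ∑ ν : (size m).Partition, _
  refine sum_congr rfl fun ν _ => ?_
  have h1 : Complex.I * (0 + 1 / 2) * kappa ν / 2 = 1 / 4 * kappa ν * Complex.I := by ring
  rw [h1, V_eq_one_div_hookProd sn hsn]
  ring

variable [Algebra ℚ K]

/-- The three assertions for abstract exponential and sine functions. -/
theorem hook_identities (hadd : ∀ a b, ex (a + b) = ex a * ex b) (h0 : ex 0 = 1)
    (hsin : ∀ a, 2 * algebraMap ℂ K Complex.I * sn a = ex (Complex.I * a) - ex (-Complex.I * a))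
    (hsn : ∀ d : ℕ, 1 ≤ d → sn ((d : ℂ) / 2) ≠ 0) :
    (∀ (n : ℕ) (ν : n.Partition), V sn ν =
        1 / (2 ^ n * ∏ x ∈ (diagram ν).cells, sn ((hook ν x : ℂ) / 2))) ∧
      MvPowerSeries.constantCoeff (hookSeries ex sn) = 1 ∧
      logSeries (hookSeries ex sn) = closedForm sn ∧
      R ex sn 0 = logSeries (RBullet ex sn 0) ∧
      R ex sn 0 = closedForm sn := by
  have : CharZero K := algebraRat.charZero K
  have hseries : hookSeries ex sn =
      PowerSeries.subst (linearSeries (logCoeff sn)) (PowerSeries.exp K) := by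
    ext m
    rw [coeff_hookSeries hadd h0 hsin hsn, coeff_subst_exp_linearSeries]
  have hconst : MvPowerSeries.constantCoeff (hookSeries ex sn) = 1 := by
    rw [← MvPowerSeries.coeff_zero_eq_constantCoeff_apply, coeff_hookSeries hadd h0 hsin hsn]
    simp [expCoeff]
  have hlog : logSeries (hookSeries ex sn) = closedForm sn := by
    rw [logSeries, hseries, log_subst_exp_linearSeries, closedForm_eq_linearSeries]
  have hR : R ex sn 0 = logSeries (RBullet ex sn 0) := by
    ext m
    rw [coeff_logSeries (by rw [RBullet_zero hsn, hconst])]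
    rfl
  refine ⟨fun n ν => ?_, hconst, hlog, hR, ?_⟩
  · rw [V_eq_one_div_hookProd sn hsn, hookProd, prod_mul_distrib, prod_const, card_diagram]
  · rw [hR, RBullet_zero hsn, hlog]

end Generic

/-! ### The two readings of `λ` -/

theorem formalExp_add (a b : ℂ) : formalExp (a + b) = formalExp a * formalExp b := by
  rw [formalExp, formalExp, formalExp, ← PowerSeries.exp_mul_exp_eq_exp_add, PowerSeries.coe_mul]

theorem formalExp_zero : formalExp 0 = 1 := by
  rw [formalExp, PowerSeries.rescale_zero]
  simp

theorem formalSin_eq (a : ℂ) :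
    2 * algebraMap ℂ (LaurentSeries ℂ) Complex.I * formalSin a =
      formalExp (Complex.I * a) - formalExp (-Complex.I * a) := by
  have h1 : PowerSeries.C (2 * Complex.I) * PowerSeries.rescale a (PowerSeries.sin ℂ) =
      PowerSeries.rescale (Complex.I * a) (PowerSeries.exp ℂ) -
        PowerSeries.rescale (-Complex.I * a) (PowerSeries.exp ℂ) := by
    ext k
    rw [map_sub, PowerSeries.coeff_C_mul, PowerSeries.coeff_rescale, PowerSeries.coeff_rescale,
      PowerSeries.coeff_rescale, PowerSeries.coeff_exp, mul_pow, mul_pow, neg_pow]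
    simp only [PowerSeries.sin, PowerSeries.coeff_mk]
    rcases Nat.even_or_odd' k with ⟨j, rfl | rfl⟩
    · simp
    · have h1 : ¬ Even (2 * j + 1) := by simp
      have h2 : (2 * j + 1) / 2 = j := by omega
      rw [if_neg h1, h2, pow_succ (-1 : ℂ), pow_mul (-1 : ℂ), neg_one_sq, one_pow,
        pow_succ Complex.I, pow_mul Complex.I, Complex.I_sq]
      simp only [map_div₀, map_pow, map_neg, map_one, map_natCast]
      ring
  have h2 := congrArg (HahnSeries.ofPowerSeries ℤ ℂ) h1
  rw [map_mul, map_sub, HahnSeries.ofPowerSeries_C] at h2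
  rw [formalSin, formalExp, formalExp, ← h2]
  congr 1
  have h3 : algebraMap ℂ (LaurentSeries ℂ) Complex.I = HahnSeries.C Complex.I := by
    rw [HahnSeries.algebraMap_apply', PowerSeries.algebraMap_apply, Algebra.algebraMap_self_apply,
      HahnSeries.ofPowerSeries_C]
  rw [h3, map_mul, map_ofNat]

/-- The linear coefficient is `d / 2`. -/
theorem formalSin_half_ne_zero (d : ℕ) (hd : 1 ≤ d) : formalSin ((d : ℂ) / 2) ≠ 0 := by
  intro h
  have h1 : PowerSeries.rescale ((d : ℂ) / 2) (PowerSeries.sin ℂ) = 0 :=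
    HahnSeries.ofPowerSeries_injective (Γ := ℤ) (R := ℂ) (h.trans (map_zero _).symm)
  have h2 := congrArg (PowerSeries.coeff 1) h1
  rw [PowerSeries.coeff_rescale] at h2
  simp [PowerSeries.sin] at h2
  omega

theorem numSin_eq (lam a : ℂ) : 2 * algebraMap ℂ ℂ Complex.I * numSin lam a =
    numExp lam (Complex.I * a) - numExp lam (-Complex.I * a) := by
  rw [numSin, numExp, numExp, Complex.sin]
  have h1 : Complex.I * a * lam = a * lam * Complex.I := by ring
  have h2 : -Complex.I * a * lam = -(a * lam) * Complex.I := by ring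
  rw [h1, h2]
  simp only [Algebra.algebraMap_self, RingHom.id_apply]
  linear_combination (Complex.exp (-(a * lam) * Complex.I) - Complex.exp (a * lam * Complex.I)) *
    Complex.I_mul_I

end

end MarinoVafa

theorem mainTheorem4 :
    -- `λ` a formal variable: identities over the field of Laurent series in `λ`
    ((∀ (n : ℕ) (ν : n.Partition), MarinoVafa.V MarinoVafa.formalSin ν =
        1 / (2 ^ n * ∏ x ∈ (MarinoVafa.diagram ν).cells,
          MarinoVafa.formalSin ((MarinoVafa.hook ν x : ℂ) / 2))) ∧
      MvPowerSeries.constantCoeff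
        (MarinoVafa.hookSeries MarinoVafa.formalExp MarinoVafa.formalSin) = 1 ∧
      MarinoVafa.logSeries (MarinoVafa.hookSeries MarinoVafa.formalExp MarinoVafa.formalSin) =
        MarinoVafa.closedForm MarinoVafa.formalSin ∧
      MarinoVafa.R MarinoVafa.formalExp MarinoVafa.formalSin 0 =
        MarinoVafa.logSeries
          (MarinoVafa.RBullet MarinoVafa.formalExp MarinoVafa.formalSin 0) ∧
      MarinoVafa.R MarinoVafa.formalExp MarinoVafa.formalSin 0 =
        MarinoVafa.closedForm MarinoVafa.formalSin) ∧
    -- `λ` a complex number at which no denominator vanishes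
    (∀ lam : ℂ, (∀ d : ℕ, 1 ≤ d → Complex.sin (d * lam / 2) ≠ 0) →
      (∀ (n : ℕ) (ν : n.Partition), MarinoVafa.V (MarinoVafa.numSin lam) ν =
        1 / (2 ^ n * ∏ x ∈ (MarinoVafa.diagram ν).cells,
          MarinoVafa.numSin lam ((MarinoVafa.hook ν x : ℂ) / 2))) ∧
      MvPowerSeries.constantCoeff
        (MarinoVafa.hookSeries (MarinoVafa.numExp lam) (MarinoVafa.numSin lam)) = 1 ∧
      MarinoVafa.logSeries
          (MarinoVafa.hookSeries (MarinoVafa.numExp lam) (MarinoVafa.numSin lam)) =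
        MarinoVafa.closedForm (MarinoVafa.numSin lam) ∧
      MarinoVafa.R (MarinoVafa.numExp lam) (MarinoVafa.numSin lam) 0 =
        MarinoVafa.logSeries
          (MarinoVafa.RBullet (MarinoVafa.numExp lam) (MarinoVafa.numSin lam) 0) ∧
      MarinoVafa.R (MarinoVafa.numExp lam) (MarinoVafa.numSin lam) 0 =
        MarinoVafa.closedForm (MarinoVafa.numSin lam)) := by
  refine ⟨MarinoVafa.hook_identities MarinoVafa.formalExp_add MarinoVafa.formalExp_zero
    MarinoVafa.formalSin_eq MarinoVafa.formalSin_half_ne_zero, fun lam hlam => ?_⟩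
  refine MarinoVafa.hook_identities (fun a b => ?_) ?_ (MarinoVafa.numSin_eq lam) fun d hd => ?_
  · rw [MarinoVafa.numExp, MarinoVafa.numExp, MarinoVafa.numExp, add_mul, Complex.exp_add]
  · rw [MarinoVafa.numExp, zero_mul, Complex.exp_zero]
  · rw [MarinoVafa.numSin, div_mul_eq_mul_div]
    exact hlam d hd
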